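/- All monoids are commutative, and a monoid inside an abelian group is written additively. A \emph{prime ideal} of a monoid $P$ is a subset $\mathfrak p\subseteq P$ with $P+\mathfrak p\subseteq\mathfrak p$ whose complement $P-\mathfrak p$ is a submonoid of $P$ (so $\mathfrak p=\emptyset$ is allowed). Let $G$ be a finitely generated free abelian group. A \emph{convex cone} in $G$ is a finitely generated submonoid $P\subseteq G$ which is saturated in the subgroup $P^{\mathrm{gp}}\subseteq G$ it generates (if $x\in P^{\mathrm{gp}}$, $n\geq 1$ and $nx\in P$, then $x\in P$), has $0$ as its only unit, and for which $G/P^{\mathrm{gp}}$ is torsion free. A \emph{fan} in $G$ is a nonempty, possibly infinite, set $\triangle$ of convex cones in $G$ such that (1) $P-\mathfrak p\in\triangle$ for all $P\in\triangle$ and all prime ideals $\mathfrak p$ of $P$; (2) for all $P,Q\in\triangle$ there are prime ideals $\mathfrak p$ of $P$ and $\mathfrak q$ of $Q$ with $P\cap Q=P-\mathfrak p=Q-\mathfrak q$. Let $R$ be a nonzero commutative ring. For $P\in\triangle$ put $\check P=\{\sigma\in\mathrm{Hom}(G,\mathbb Z) : \sigma(x)\geq 0\ \text{for all}\ x\in P\}$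 and $U_P=\operatorname{Spec}R[\check P]$. For $Q\subseteq P$ in $\triangle$ the inclusion $\check P\subseteq\check Q$ induces an open immersion $U_Q\to U_P$, and the toric scheme $X_R(\triangle)$ is obtained by gluing the $U_P$, $P\in\triangle$, along $U_P\cap U_Q=U_{P\cap Q}$. Let $\triangle$ and $\triangle'$ be fans in finitely generated free abelian groups $G$ and $G'$, and let $\varphi\colon(G,\triangle)\to(G',\triangle')$ be a homomorphism of fans, i.e. a group homomorphism $\varphi\colon G\to G'$ such that for each $P\in\triangle$ there is a $P'\in\triangle'$ with $\varphi(P)\subseteq P'$. Let $\varphi_*\colon X_R(\triangle)\to X_R(\triangle')$ be the induced morphism, given for $\varphi(P)\subseteq P'$ on charts by the morphism $U_P\to U_{P'}$ coming from $\check P'\to\check P$, $\sigma\mapsto\sigma\circ\varphi$. \textbf{Theorem.} The morphism $\varphi_*$ is proper if and only if for each $P'\in\triangle'$ the set \[\triangle_{P'}=\{P\in\triangle : \varphi(P)\subseteq P'\}\] is finite and \[\varphi^{-1}(P')=\bigcup_{P\in\triangle_{P'}}P .\] -/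

import Mathlib

open CategoryTheory CategoryTheory.Limits AlgebraicGeometry

universe u

namespace ToricFan

section Monoids

/-- A prime ideal of a (commutative, additive) monoid: an ideal whose complement is a submonoid.
The empty ideal is prime; the improper ideal is not. -/
def IsPrimeIdeal {M : Type*} [AddCommMonoid M] (I : AddSemigroupIdeal M) : Prop :=
  ∃ S : AddSubmonoid M, (S : Set M) = (I : Set M)ᶜ

/-- `Q = P - 𝔭` for some prime ideal `𝔭` of the monoid `P`. -/
def IsFace {G : Type*} [AddCommGroup G] (P Q : AddSubmonoid G) : Prop :=
  ∃ I : AddSemigroupIdeal P, IsPrimeIdeal I ∧ (Q : Set G) = (Subtype.val '' (I : Set P)ᶜ)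

/-- A convex cone in a group `G`: a finitely generated submonoid `P` which is saturated (in the
group `P - P` that it generates), has no nonzero units, and for which `G / (P - P)` is
torsion free. -/
structure IsConvexCone {G : Type*} [AddCommGroup G] (P : AddSubmonoid G) : Prop where
  fg : P.FG
  saturated : ∀ x ∈ AddSubgroup.closure (P : Set G), ∀ n : ℕ, 0 < n → n • x ∈ P → x ∈ P
  sharp : ∀ x ∈ P, -x ∈ P → x = 0
  torsionFree : IsAddTorsionFree (G ⧸ AddSubgroup.closure (P : Set G))

/-- A fan in `G`: a nonempty, possibly infinite, collection of convex cones in `G`, closed under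
passing to faces, in which any two cones meet in a common face. -/
structure Fan (G : Type*) [AddCommGroup G] where
  cones : Set (AddSubmonoid G)
  nonempty : cones.Nonempty
  isConvexCone : ∀ P ∈ cones, IsConvexCone P
  face_mem : ∀ P ∈ cones, ∀ Q, IsFace P Q → Q ∈ cones
  inter : ∀ P ∈ cones, ∀ Q ∈ cones, IsFace P (P ⊓ Q) ∧ IsFace Q (P ⊓ Q)

/-- A homomorphism of fans: a homomorphism of groups mapping every cone of the source into some
cone of the target. -/
structure FanHom {G G' : Type*} [AddCommGroup G] [AddCommGroup G'] (Δ : Fan G) (Δ' : Fan G')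
    extends G →+ G' where
  exists_map_le : ∀ P ∈ Δ.cones, ∃ P' ∈ Δ'.cones, P.map toAddMonoidHom ≤ P'

/-- The dual cone `{σ ∈ Hom(G, ℤ) | ∀ x ∈ P, 0 ≤ σ x}`. -/
def dualCone {G : Type*} [AddCommGroup G] (P : AddSubmonoid G) : AddSubmonoid (G →+ ℤ) where
  carrier := {σ | ∀ x ∈ P, 0 ≤ σ x}
  zero_mem' := fun _ _ => le_rfl
  add_mem' := fun ha hb x hx => add_nonneg (ha x hx) (hb x hx)

/-- If `φ` maps `P` into `P'`, composition with `φ` maps the dual cone of `P'` to that of `P`. -/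
def dualConeMap {G G' : Type*} [AddCommGroup G] [AddCommGroup G'] {P : AddSubmonoid G}
    {P' : AddSubmonoid G'} (φ : G →+ G') (h : P.map φ ≤ P') : dualCone P' →+ dualCone P where
  toFun σ := ⟨σ.1.comp φ, fun x hx => σ.2 (φ x) (h ⟨x, hx, rfl⟩)⟩
  map_zero' := rfl
  map_add' _ _ := rfl

theorem IsFace.le {G : Type*} [AddCommGroup G] {P Q : AddSubmonoid G} (h : IsFace P Q) :
    Q ≤ P := by
  obtain ⟨I, -, hQ⟩ := h
  intro x hx
  rw [← SetLike.mem_coe, hQ] at hx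
  obtain ⟨y, -, rfl⟩ := hx
  exact y.2

/-- Gordan's theorem: finitely many elements of an abelian group without a nontrivial relation
with nonnegative coefficients are all positive under some homomorphism to `ℚ`. -/
theorem exists_hom_pos (n : ℕ) : ∀ {A : Type u} [AddCommGroup A] (x : Fin n → A),
    (∀ a : Fin n → ℕ, ∑ i, a i • x i = 0 → a = 0) → ∃ m : A →+ ℚ, ∀ i, 0 < m (x i) := by
  induction n with
  | zero => exact fun x _ => ⟨0, fun i => i.elim0⟩
  | succ n ih =>
    intro A _ x hx
    have hx' : ∀ a : Fin n → ℕ, ∑ i, a i • x i.succ = 0 → a = 0 := by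
      intro a ha
      have := hx (Fin.cons 0 a) (by simpa [Fin.sum_univ_succ] using ha)
      funext i
      simpa using congrFun this i.succ
    by_cases h : ∀ a : Fin n → ℕ,
        ∑ i, a i • (QuotientAddGroup.mk (x i.succ) : A ⧸ AddSubgroup.zmultiples (x 0)) = 0 → a = 0
    · obtain ⟨m, hm⟩ := ih _ h
      have hinj : Function.Injective (zmultiplesHom A (x 0)) := by
        rw [injective_iff_map_eq_zero]
        intro k hk
        have hk' : k.natAbs • x 0 = 0 := by
          have hk1 : k • x 0 = 0 := by simpa using hk
          rcases Int.natAbs_eq k with h1 | h1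
          · rw [h1] at hk1
            simpa using hk1
          · rw [h1] at hk1
            simpa using hk1
        have := hx (Fin.cons k.natAbs 0) (by simpa [Fin.sum_univ_succ] using hk')
        have := congrFun this 0
        simpa using this
      obtain ⟨m₀, hm₀⟩ := (Module.Baer.of_divisible ℚ).extension_property_addMonoidHom
        (zmultiplesHom A (x 0)) hinj (Int.castAddHom ℚ)
      have hm1 : m₀ (x 0) = 1 := by
        have := DFunLike.congr_fun hm₀ (1 : ℤ)
        simpa using this
      let m' : A →+ ℚ := m.comp (QuotientAddGroup.mk' _)
      have hm' : ∀ i : Fin n, 0 < m' (x i.succ) := hm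
      have hm'0 : m' (x 0) = 0 := by
        have : (QuotientAddGroup.mk' (AddSubgroup.zmultiples (x 0))) (x 0) = 0 := by simp
        simp only [m', AddMonoidHom.comp_apply, this, map_zero]
      obtain ⟨N, hN⟩ : ∃ N : ℕ, ∀ i : Fin n, 0 < N * m' (x i.succ) + m₀ (x i.succ) := by
        have h1 : ∀ i : Fin n, ∀ᶠ N : ℕ in Filter.atTop,
            0 < N * m' (x i.succ) + m₀ (x i.succ) := fun i =>
          (Filter.tendsto_atTop_add_const_right _ _
            (tendsto_natCast_atTop_atTop.atTop_mul_const (hm' i))).eventually_gt_atTop 0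
        exact (Filter.eventually_all.2 h1).exists
      refine ⟨N • m' + m₀, fun i => ?_⟩
      refine Fin.cases ?_ (fun i => ?_) i
      · simp [hm'0, hm1]
      · simpa using hN i
    · push Not at h
      obtain ⟨a, ha, ha0⟩ := h
      have h1 : ∑ i, a i • x i.succ ∈ AddSubgroup.zmultiples (x 0) := by
        rw [← QuotientAddGroup.eq_zero_iff]
        simpa using ha
      obtain ⟨c, hc⟩ := AddSubgroup.mem_zmultiples_iff.1 h1
      obtain ⟨m, hm⟩ := ih _ hx'
      have hpos : 0 < m (∑ i, a i • x i.succ) := by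
        rw [map_sum]
        obtain ⟨j, hj⟩ := Function.ne_iff.1 ha0
        refine Finset.sum_pos' (fun i _ => ?_) ⟨j, Finset.mem_univ _, ?_⟩
        · rw [map_nsmul]
          exact nsmul_nonneg (hm i).le _
        · rw [map_nsmul]
          exact nsmul_pos (hm j) hj
      rcases lt_or_ge 0 c with h2 | h2
      · refine ⟨m, fun i => Fin.cases ?_ (fun i => hm i) i⟩
        rw [← hc, map_zsmul, zsmul_eq_mul] at hpos
        exact pos_of_mul_pos_right hpos (by exact_mod_cast h2.le)
      · exfalso
        have h3 : (-c).toNat • x 0 = -(c • x 0) := by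
          rw [← natCast_zsmul, Int.toNat_of_nonneg (by omega), neg_smul]
        have := hx (Fin.cons (-c).toNat a) (by
          simp only [Fin.sum_univ_succ, Fin.cons_zero, Fin.cons_succ]
          rw [h3, hc, neg_add_cancel])
        exact ha0 (funext fun i => by simpa using congrFun this i.succ)

/-- A face of a finitely generated submonoid `P` of a finitely generated group is cut out by an
element of the dual cone of `P`. -/
theorem IsFace.exists_dual {G : Type u} [AddCommGroup G] [Module.Finite ℤ G]
    {P Q : AddSubmonoid G} (hP : P.FG) (h : IsFace P Q) :
    ∃ m ∈ dualCone P, ∀ x ∈ P, m x = 0 ↔ x ∈ Q := by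
  classical
  have hle := h.le
  obtain ⟨I, ⟨S, hS⟩, hQ⟩ := h
  have hIQ : ∀ y : P, y ∈ I ↔ (y : G) ∉ Q := by
    intro y
    rw [← SetLike.mem_coe (p := Q), hQ]
    simp
  -- the face is closed under taking summands
  have hface : ∀ x ∈ P, ∀ y ∈ P, x + y ∈ Q → x ∈ Q := by
    intro x hx y hy hxy
    by_contra hx'
    have h1 : (⟨x, hx⟩ : P) ∈ I := (hIQ _).2 hx'
    have h2 : (⟨y, hy⟩ : P) + ⟨x, hx⟩ ∈ I := AddSemigroupIdeal.add_mem I _ h1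
    exact (hIQ _).1 h2 (by simpa [add_comm] using hxy)
  obtain ⟨s, hs⟩ := hP
  have hsP : ∀ x ∈ s, x ∈ P := fun x hx => hs ▸ AddSubmonoid.subset_closure hx
  let t := s.filter (· ∉ Q)
  let e := t.equivFin
  have hgrp : ∀ x ∈ AddSubgroup.closure (Q : Set G), ∃ y ∈ Q, ∃ z ∈ Q, x = y - z := by
    intro x hx
    induction hx using AddSubgroup.closure_induction with
    | mem x hx => exact ⟨x, hx, 0, Q.zero_mem, by simp⟩
    | zero => exact ⟨0, Q.zero_mem, 0, Q.zero_mem, by simp⟩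
    | add x y _ _ hx hy =>
      obtain ⟨a, ha, b, hb, rfl⟩ := hx
      obtain ⟨c, hc, d, hd, rfl⟩ := hy
      exact ⟨a + c, Q.add_mem ha hc, b + d, Q.add_mem hb hd, by abel⟩
    | neg x _ hx =>
      obtain ⟨a, ha, b, hb, rfl⟩ := hx
      exact ⟨b, hb, a, ha, by abel⟩
  obtain ⟨m, hm⟩ := exists_hom_pos t.card
    (fun i => (QuotientAddGroup.mk ((e.symm i : t) : G) : G ⧸ AddSubgroup.closure (Q : Set G)))
    (by
      intro a ha
      have h1 : ∑ i, a i • ((e.symm i : t) : G) ∈ AddSubgroup.closure (Q : Set G) := by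
        rw [← QuotientAddGroup.eq_zero_iff]
        simpa using ha
      obtain ⟨y, hy, z, hz, hyz⟩ := hgrp _ h1
      have hmemP : ∀ i, ((e.symm i : t) : G) ∈ P := fun i =>
        hsP _ (Finset.mem_filter.1 (e.symm i).2).1
      funext i
      by_contra hi
      obtain ⟨k, hk⟩ := Nat.exists_eq_succ_of_ne_zero hi
      have hsum : (∑ j, a j • ((e.symm j : t) : G)) + z = y := by rw [hyz]; abel
      rw [← Finset.add_sum_erase _ _ (Finset.mem_univ i), hk, succ_nsmul'] at hsum
      refine (Finset.mem_filter.1 (e.symm i).2).2 (hface _ (hmemP i)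
        (k • ((e.symm i : t) : G) + (∑ j ∈ Finset.univ.erase i, a j • ((e.symm j : t) : G) + z))
        ?_ ?_)
      · exact P.add_mem (P.nsmul_mem (hmemP i) _) (P.add_mem
          (P.sum_mem fun j _ => P.nsmul_mem (hmemP j) _) (hle hz))
      · rw [show ((e.symm i : t) : G) + (k • ((e.symm i : t) : G) +
          (∑ j ∈ Finset.univ.erase i, a j • ((e.symm j : t) : G) + z)) = y by
            rw [← hsum]; abel]
        exact hy)
  let m₁ : G →+ ℚ := m.comp (QuotientAddGroup.mk' _)
  have hm₁Q : ∀ x ∈ Q, m₁ x = 0 := by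
    intro x hx
    have : (QuotientAddGroup.mk' (AddSubgroup.closure (Q : Set G))) x = 0 :=
      (QuotientAddGroup.eq_zero_iff x).2 (AddSubgroup.subset_closure hx)
    simp only [m₁, AddMonoidHom.comp_apply, this, map_zero]
  have hm₁t : ∀ x ∈ s, x ∉ Q → 0 < m₁ x := by
    intro x hx hxQ
    have := hm (e ⟨x, Finset.mem_filter.2 ⟨hx, hxQ⟩⟩)
    simp only [Equiv.symm_apply_apply] at this
    exact this
  -- clear denominators
  obtain ⟨d, hd, hdint⟩ : ∃ d : ℕ, 0 < d ∧ ∀ x : G, ∃ k : ℤ, (k : ℚ) = d * m₁ x := by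
    obtain ⟨g, hg⟩ := Module.Finite.fg_top (R := ℤ) (M := G)
    refine ⟨∏ x ∈ g, (m₁ x).den, Finset.prod_pos fun x _ => (m₁ x).den_pos, fun x => ?_⟩
    have hx : x ∈ Submodule.span ℤ (g : Set G) := hg ▸ Submodule.mem_top
    induction hx using Submodule.span_induction with
    | mem x hx =>
      refine ⟨(∏ y ∈ g.erase x, (m₁ y).den : ℕ) * (m₁ x).num, ?_⟩
      rw [← Finset.mul_prod_erase g _ hx]
      push_cast
      rw [mul_right_comm, Rat.den_mul_eq_num, mul_comm]
    | zero => exact ⟨0, by simp⟩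
    | add x y _ _ hx hy =>
      obtain ⟨a, ha⟩ := hx
      obtain ⟨b, hb⟩ := hy
      exact ⟨a + b, by rw [Int.cast_add, ha, hb, map_add, mul_add]⟩
    | smul c x _ hx =>
      obtain ⟨a, ha⟩ := hx
      exact ⟨c * a, by rw [Int.cast_mul, ha, map_zsmul, zsmul_eq_mul, mul_left_comm]⟩
  choose f hf using hdint
  let m₂ : G →+ ℤ := AddMonoidHom.mk' f (fun x y => by
    have : (f (x + y) : ℚ) = (f x + f y : ℤ) := by
      push_cast
      rw [hf, hf, hf, map_add]
      ring
    exact_mod_cast this)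
  have hm₂ : ∀ x, (m₂ x : ℚ) = d * m₁ x := hf
  have hd' : (0 : ℚ) < d := by exact_mod_cast hd
  have hm₂Q : ∀ x ∈ Q, m₂ x = 0 := by
    intro x hx
    have := hm₂ x
    rw [hm₁Q x hx, mul_zero] at this
    exact_mod_cast this
  have hm₂t : ∀ x ∈ s, x ∉ Q → 0 < m₂ x := by
    intro x hx hxQ
    have : (0 : ℚ) < m₂ x := by
      rw [hm₂ x]
      exact mul_pos hd' (hm₁t x hx hxQ)
    exact_mod_cast this
  have key : ∀ x ∈ P, 0 ≤ m₂ x ∧ (m₂ x = 0 → x ∈ Q) := by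
    intro x hx
    rw [← hs] at hx
    induction hx using AddSubmonoid.closure_induction with
    | mem x hx =>
      by_cases hxQ : x ∈ Q
      · exact ⟨(hm₂Q x hxQ).ge, fun _ => hxQ⟩
      · have := hm₂t x hx hxQ
        exact ⟨this.le, fun h0 => absurd h0 this.ne'⟩
    | zero => exact ⟨by simp, fun _ => Q.zero_mem⟩
    | add x y _ _ hx hy =>
      refine ⟨by rw [map_add]; exact add_nonneg hx.1 hy.1, fun h0 => ?_⟩
      rw [map_add] at h0
      have h1 := hx.1
      have h2 := hy.1
      exact Q.add_mem (hx.2 (by omega)) (hy.2 (by omega))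
  exact ⟨m₂, fun x hx => (key x hx).1, fun x hx => ⟨(key x hx).2, hm₂Q x⟩⟩

/-- If `m` cuts out `Q` in `P`, then every element of the dual cone of `Q` lies in the dual cone
of `P` after adding a multiple of `m`. -/
theorem exists_add_nsmul_mem {G : Type*} [AddCommGroup G] {P Q : AddSubmonoid G} (hP : P.FG)
    {m : G →+ ℤ} (hm : m ∈ dualCone P) (hmQ : ∀ x ∈ P, m x = 0 ↔ x ∈ Q) {σ : G →+ ℤ}
    (hσ : σ ∈ dualCone Q) : ∃ n₀ : ℕ, ∀ n ≥ n₀, σ + n • m ∈ dualCone P := by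
  classical
  obtain ⟨s, hs⟩ := hP
  have hsP : ∀ x ∈ s, x ∈ P := fun x hx => hs ▸ AddSubmonoid.subset_closure hx
  refine ⟨∑ x ∈ s, (σ x).natAbs, fun n hn x hx => ?_⟩
  rw [← hs] at hx
  induction hx using AddSubmonoid.closure_induction with
  | mem x hx =>
    have h0 : 0 ≤ m x := hm x (hsP x hx)
    simp only [AddMonoidHom.add_apply, AddMonoidHom.nsmul_apply, nsmul_eq_mul]
    by_cases hxQ : x ∈ Q
    · exact add_nonneg (hσ x hxQ) (by positivity)
    · have h1 : 1 ≤ m x := by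
        have : m x ≠ 0 := fun h => hxQ ((hmQ x (hsP x hx)).1 h)
        omega
      have h2 : (σ x).natAbs ≤ n :=
        (Finset.single_le_sum (f := fun x => (σ x).natAbs) (fun _ _ => Nat.zero_le _) hx).trans hn
      have h3 : (n : ℤ) ≤ n * m x := le_mul_of_one_le_right (by positivity) h1
      omega
  | zero => simp
  | add x y _ _ hx hy => rw [map_add]; exact add_nonneg hx hy

end Monoids

noncomputable section Schemes

/-- The ring homomorphism `R[P'^∨] → R[P^∨]` induced by `φ` with `φ(P) ⊆ P'`. -/
def chartRingMap (R : Type u) [CommRing R] {G G' : Type u} [AddCommGroup G] [AddCommGroup G']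
    {P : AddSubmonoid G} {P' : AddSubmonoid G'} (φ : G →+ G') (h : P.map φ ≤ P') :
    AddMonoidAlgebra R (dualCone P') →+* AddMonoidAlgebra R (dualCone P) :=
  AddMonoidAlgebra.mapDomainRingHom R (dualConeMap φ h)

/-- The affine chart `U_P = Spec R[P^∨]`. -/
def chart (R : Type u) [CommRing R] {G : Type u} [AddCommGroup G] (P : AddSubmonoid G) :
    Scheme.{u} :=
  Spec (CommRingCat.of (AddMonoidAlgebra R (dualCone P)))

/-- The morphism of charts `U_P → U_{P'}` induced by `φ` with `φ(P) ⊆ P'`. -/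
def chartMap (R : Type u) [CommRing R] {G G' : Type u} [AddCommGroup G] [AddCommGroup G']
    {P : AddSubmonoid G} {P' : AddSubmonoid G'} (φ : G →+ G') (h : P.map φ ≤ P') :
    chart R P ⟶ chart R P' :=
  Spec.map (CommRingCat.ofHom (chartRingMap R φ h))

theorem chartMap_id (R : Type u) [CommRing R] {G : Type u} [AddCommGroup G]
    {P : AddSubmonoid G} (h : P.map (AddMonoidHom.id G) ≤ P) :
    chartMap R (AddMonoidHom.id G) h = 𝟙 (chart R P) := by
  have : chartRingMap R (AddMonoidHom.id G) h = RingHom.id _ := by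
    have h1 : dualConeMap (AddMonoidHom.id G) h = AddMonoidHom.id _ := rfl
    rw [chartRingMap, h1]
    ext <;> simp
  rw [chartMap, this]
  exact Spec.map_id _

theorem chartMap_comp (R : Type u) [CommRing R] {G G' G'' : Type u} [AddCommGroup G]
    [AddCommGroup G'] [AddCommGroup G''] {P : AddSubmonoid G} {P' : AddSubmonoid G'}
    {P'' : AddSubmonoid G''} (φ : G →+ G') (h : P.map φ ≤ P') (ψ : G' →+ G'')
    (h' : P'.map ψ ≤ P'') (χ : G →+ G'') (h'' : P.map χ ≤ P'') (hχ : χ = ψ.comp φ) :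
    chartMap R φ h ≫ chartMap R ψ h' = chartMap R χ h'' := by
  subst hχ
  have : chartRingMap R (ψ.comp φ) h'' = (chartRingMap R φ h).comp (chartRingMap R ψ h') := by
    have h1 : dualConeMap (ψ.comp φ) h'' = (dualConeMap φ h).comp (dualConeMap ψ h') := rfl
    rw [chartRingMap, h1]
    ext <;> simp [chartRingMap]
  rw [chartMap, chartMap, chartMap, this, CommRingCat.ofHom_comp]
  exact (Spec.map_comp _ _).symm

/-- The hypothesis `Q ⊆ P` in the form used by `chartMap`. -/
theorem map_id_le {G : Type*} [AddCommGroup G] {Q P : AddSubmonoid G} (h : Q ≤ P) :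
    Q.map (AddMonoidHom.id G) ≤ P := by
  rintro _ ⟨x, hx, rfl⟩
  exact h hx

/-- If `m` in the dual cone of `P` cuts out `Q`, then `R[Q^∨]` is the localization of `R[P^∨]` at
the monomial of `m`. -/
theorem isLocalization_chartRingMap (R : Type u) [CommRing R] {G : Type u} [AddCommGroup G]
    {P Q : AddSubmonoid G} (hP : P.FG) (hQ : Q ≤ P) (m : dualCone P)
    (hmQ : ∀ x ∈ P, m.1 x = 0 ↔ x ∈ Q) :
    letI := (chartRingMap R (AddMonoidHom.id G) (map_id_le hQ)).toAlgebra
    IsLocalization.Away (AddMonoidAlgebra.single m (1 : R))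
      (AddMonoidAlgebra R (dualCone Q)) := by
  let _ := (chartRingMap R (AddMonoidHom.id G) (map_id_le hQ)).toAlgebra
  let ι : dualCone P →+ dualCone Q := dualConeMap (AddMonoidHom.id G) (map_id_le hQ)
  have hι : ∀ σ, (ι σ).1 = σ.1 := fun σ => rfl
  have hιinj : Function.Injective ι := fun a b hab => Subtype.ext congr(($hab).1)
  have halg : ∀ a : AddMonoidAlgebra R (dualCone P),
      algebraMap _ (AddMonoidAlgebra R (dualCone Q)) a = AddMonoidAlgebra.mapDomain ι a :=
    fun a => rfl
  have hneg : -m.1 ∈ dualCone Q := fun x hx => by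
    simp [(hmQ x (hQ hx)).2 hx]
  have hpow : ∀ n : ℕ, (AddMonoidAlgebra.single m (1 : R)) ^ n =
      AddMonoidAlgebra.single (n • m) (1 : R) := fun n => by
    rw [AddMonoidAlgebra.single_pow, one_pow]
  have hinj : Function.Injective
      (algebraMap (AddMonoidAlgebra R (dualCone P)) (AddMonoidAlgebra R (dualCone Q))) :=
    AddMonoidAlgebra.mapDomain_injective hιinj
  refine (isLocalization_iff _ _).2 ⟨?_, ?_, ?_⟩
  · rintro ⟨_, n, rfl⟩
    change IsUnit (algebraMap _ _ ((AddMonoidAlgebra.single m (1 : R)) ^ n))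
    rw [map_pow]
    refine IsUnit.pow n (IsUnit.of_mul_eq_one (AddMonoidAlgebra.single ⟨_, hneg⟩ 1) ?_)
    rw [halg, AddMonoidAlgebra.mapDomain_single, AddMonoidAlgebra.single_mul_single,
      AddMonoidAlgebra.one_def, mul_one]
    congr 1
    exact Subtype.ext (by simp [hι])
  · intro z
    have : ∃ n₀ : ℕ, ∀ n ≥ n₀, ∃ a : AddMonoidAlgebra R (dualCone P),
        z * algebraMap _ _ ((AddMonoidAlgebra.single m (1 : R)) ^ n) = algebraMap _ _ a := by
      induction z using AddMonoidAlgebra.induction_linear with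
      | zero => exact ⟨0, fun n _ => ⟨0, by simp⟩⟩
      | add x y hx hy =>
        obtain ⟨a, ha⟩ := hx
        obtain ⟨b, hb⟩ := hy
        refine ⟨max a b, fun n hn => ?_⟩
        obtain ⟨x', hx'⟩ := ha n (le_of_max_le_left hn)
        obtain ⟨y', hy'⟩ := hb n (le_of_max_le_right hn)
        exact ⟨x' + y', by rw [add_mul, hx', hy', map_add]⟩
      | single σ r =>
        obtain ⟨n₀, h⟩ := exists_add_nsmul_mem hP m.2 hmQ σ.2
        refine ⟨n₀, fun n hn => ⟨AddMonoidAlgebra.single ⟨_, h n hn⟩ r, ?_⟩⟩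
        rw [hpow, halg, halg, AddMonoidAlgebra.mapDomain_single,
          AddMonoidAlgebra.mapDomain_single, AddMonoidAlgebra.single_mul_single, mul_one]
        congr 1
    obtain ⟨n, hn⟩ := this
    obtain ⟨a, ha⟩ := hn n le_rfl
    exact ⟨⟨a, ⟨_, n, rfl⟩⟩, ha⟩
  · intro x y hxy
    exact ⟨1, by rw [hinj hxy]⟩

theorem isOpenImmersion_chartMap (R : Type u) [CommRing R] {G : Type u} [AddCommGroup G]
    [Module.Finite ℤ G] {P Q : AddSubmonoid G} (hP : P.FG) (hQ : IsFace P Q)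
    (hle : Q.map (AddMonoidHom.id G) ≤ P) :
    IsOpenImmersion (chartMap R (AddMonoidHom.id G) hle) := by
  obtain ⟨m, hm, hmQ⟩ := hQ.exists_dual hP
  let _ := (chartRingMap R (AddMonoidHom.id G) (map_id_le hQ.le)).toAlgebra
  have := isLocalization_chartRingMap R hP hQ.le ⟨m, hm⟩ hmQ
  exact IsOpenImmersion.of_isLocalization (S := AddMonoidAlgebra R (dualCone Q))
    (AddMonoidAlgebra.single (⟨m, hm⟩ : dualCone P) (1 : R))

theorem range_chartMap (R : Type u) [CommRing R] {G : Type u} [AddCommGroup G]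
    {P Q : AddSubmonoid G} (hP : P.FG) (hQ : Q ≤ P) (m : dualCone P)
    (hmQ : ∀ x ∈ P, m.1 x = 0 ↔ x ∈ Q) :
    Set.range (chartMap R (AddMonoidHom.id G) (map_id_le hQ)) =
      ((PrimeSpectrum.basicOpen (AddMonoidAlgebra.single m (1 : R)) :
        TopologicalSpace.Opens (PrimeSpectrum (AddMonoidAlgebra R (dualCone P)))) :
        Set (PrimeSpectrum (AddMonoidAlgebra R (dualCone P)))) := by
  let _ := (chartRingMap R (AddMonoidHom.id G) (map_id_le hQ)).toAlgebra
  have := isLocalization_chartRingMap R hP hQ m hmQ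
  exact PrimeSpectrum.localization_away_comap_range (AddMonoidAlgebra R (dualCone Q))
    (AddMonoidAlgebra.single m (1 : R))

variable {G G' : Type u} [AddCommGroup G] [AddCommGroup G']

theorem Fan.isFace_of_le (Δ : Fan G) {P Q : AddSubmonoid G} (hP : P ∈ Δ.cones)
    (hQ : Q ∈ Δ.cones) (h : Q ≤ P) : IsFace P Q := by
  have := (Δ.inter P hP Q hQ).1
  rwa [inf_eq_right.2 h] at this

theorem Fan.inf_mem (Δ : Fan G) {P Q : AddSubmonoid G} (hP : P ∈ Δ.cones)
    (hQ : Q ∈ Δ.cones) : P ⊓ Q ∈ Δ.cones :=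
  Δ.face_mem P hP _ (Δ.inter P hP Q hQ).1

/-- The diagram of charts `U_P` for `P` in the fan, ordered by inclusion, with the open immersions
`U_Q → U_P` for `Q ⊆ P`. -/
def Fan.diagram (R : Type u) [CommRing R] (Δ : Fan G) : Δ.cones ⥤ Scheme.{u} where
  obj P := chart R P.1
  map f := chartMap R (AddMonoidHom.id G) (map_id_le (leOfHom f))
  map_id P := chartMap_id R (map_id_le (le_refl P.1))
  map_comp f g := (chartMap_comp R (AddMonoidHom.id G) (map_id_le (leOfHom f))
    (AddMonoidHom.id G) (map_id_le (leOfHom g)) (AddMonoidHom.id G)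
    (map_id_le (leOfHom (f ≫ g))) rfl).symm

instance (R : Type u) [CommRing R] [Module.Finite ℤ G] (Δ : Fan G) {P Q : Δ.cones} (f : P ⟶ Q) :
    IsOpenImmersion ((Δ.diagram R).map f) :=
  isOpenImmersion_chartMap R (Δ.isConvexCone _ Q.2).fg
    (Δ.isFace_of_le Q.2 P.2 (leOfHom f)) _

/-- Inside `U_S`, the charts `U_P` and `U_Q` meet in `U_{P ∩ Q}`. -/
instance (R : Type u) [CommRing R] [Module.Finite ℤ G] (Δ : Fan G) :
    (Δ.diagram R ⋙ Scheme.forget).IsLocallyDirected where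
  cond := by
    intro P Q S fP fQ x y hxy
    have hP := leOfHom fP
    have hQ := leOfHom fQ
    let T : Δ.cones := ⟨P.1 ⊓ Q.1, Δ.inf_mem P.2 Q.2⟩
    have hfg := (Δ.isConvexCone _ S.2).fg
    obtain ⟨m, hm, hmP⟩ := (Δ.isFace_of_le S.2 P.2 hP).exists_dual hfg
    obtain ⟨n, hn, hnQ⟩ := (Δ.isFace_of_le S.2 Q.2 hQ).exists_dual hfg
    have hTS : T.1 ≤ S.1 := inf_le_left.trans hP
    let gP : T ⟶ P := homOfLE (show T.1 ≤ P.1 from inf_le_left)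
    let gQ : T ⟶ Q := homOfLE (show T.1 ≤ Q.1 from inf_le_right)
    have rP := range_chartMap R hfg hP ⟨m, hm⟩ hmP
    have rQ := range_chartMap R hfg hQ ⟨n, hn⟩ hnQ
    have rT := range_chartMap R hfg hTS (⟨m, hm⟩ + ⟨n, hn⟩) (by
      intro z hz
      have h1 := hm z hz
      have h2 := hn z hz
      have h3 := hmP z hz
      have h4 := hnQ z hz
      change m z + n z = 0 ↔ z ∈ P.1 ∧ z ∈ Q.1
      rw [← h3, ← h4]
      omega)
    have hx : (Δ.diagram R).map fP x = (Δ.diagram R).map fQ y := hxy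
    have hmem : (Δ.diagram R).map fP x ∈
        Set.range (chartMap R (AddMonoidHom.id G) (map_id_le hTS)) := by
      have h1 : (Δ.diagram R).map fP x ∈
          Set.range (chartMap R (AddMonoidHom.id G) (map_id_le hP)) := ⟨x, rfl⟩
      have h2 : (Δ.diagram R).map fP x ∈
          Set.range (chartMap R (AddMonoidHom.id G) (map_id_le hQ)) := hx ▸ ⟨y, rfl⟩
      rw [rP] at h1
      rw [rQ] at h2
      rw [rT, ← one_mul (1 : R), ← AddMonoidAlgebra.single_mul_single,
        PrimeSpectrum.basicOpen_mul]
      exact ⟨h1, h2⟩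
    obtain ⟨z, hz⟩ := hmem
    change (Δ.diagram R).obj T at z
    refine ⟨T, gP, gQ, z, ?_, ?_⟩
    · have h1 : (Δ.diagram R).map (gP ≫ fP) z = (Δ.diagram R).map fP x := hz
      rw [Functor.map_comp, Scheme.Hom.comp_apply] at h1
      exact ((Δ.diagram R).map fP).isOpenEmbedding.injective h1
    · have h1 : (Δ.diagram R).map (gQ ≫ fQ) z = (Δ.diagram R).map fQ y := hz.trans hx
      rw [Functor.map_comp, Scheme.Hom.comp_apply] at h1
      exact ((Δ.diagram R).map fQ).isOpenEmbedding.injective h1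

/-- The toric scheme over `R` of a fan: the charts `U_P`, glued along `U_P ∩ U_Q = U_{P ∩ Q}`. -/
def Fan.toricScheme (R : Type u) [CommRing R] [Module.Finite ℤ G] (Δ : Fan G) : Scheme.{u} :=
  colimit (Δ.diagram R)

/-- The open immersion of the chart `U_P` into the toric scheme. -/
def Fan.chartι (R : Type u) [CommRing R] [Module.Finite ℤ G] (Δ : Fan G) {P : AddSubmonoid G}
    (hP : P ∈ Δ.cones) : chart R P ⟶ Δ.toricScheme R :=
  colimit.ι (Δ.diagram R) ⟨P, hP⟩

theorem Fan.chartMap_chartι (R : Type u) [CommRing R] [Module.Finite ℤ G] (Δ : Fan G)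
    {P Q : AddSubmonoid G} (hP : P ∈ Δ.cones) (hQ : Q ∈ Δ.cones)
    (h : Q.map (AddMonoidHom.id G) ≤ P) :
    chartMap R (AddMonoidHom.id G) h ≫ Δ.chartι R hP = Δ.chartι R hQ :=
  colimit.w (Δ.diagram R)
    (homOfLE (show (⟨Q, hQ⟩ : Δ.cones) ≤ ⟨P, hP⟩ from fun x hx => h ⟨x, hx, rfl⟩))

/-- The morphisms `U_P → U_{P'} → X(Δ')` do not depend on the choice of `P'` with `φ(P) ⊆ P'`. -/
theorem Fan.chartMap_chartι_eq (R : Type u) [CommRing R] [Module.Finite ℤ G'] (Δ' : Fan G')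
    (φ : G →+ G') {P : AddSubmonoid G} {P' P'' : AddSubmonoid G'} (hP' : P' ∈ Δ'.cones)
    (hP'' : P'' ∈ Δ'.cones) (h' : P.map φ ≤ P') (h'' : P.map φ ≤ P'') :
    chartMap R φ h' ≫ Δ'.chartι R hP' = chartMap R φ h'' ≫ Δ'.chartι R hP'' := by
  have hT := Δ'.inf_mem hP' hP''
  rw [← chartMap_comp R φ (le_inf h' h'') (AddMonoidHom.id G') (map_id_le inf_le_left) φ h' rfl,
    ← chartMap_comp R φ (le_inf h' h'') (AddMonoidHom.id G') (map_id_le inf_le_right) φ h'' rfl,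
    Category.assoc, Category.assoc, Δ'.chartMap_chartι R hP' hT, Δ'.chartMap_chartι R hP'' hT]

/-- The morphism of toric schemes induced by a homomorphism of fans `φ`. On the chart `U_P` it is
the morphism `U_P → U_{P'}` induced by `φ`, for any `P'` in `Δ'` with `φ(P) ⊆ P'`. -/
def FanHom.toricMap (R : Type u) [CommRing R] [Module.Finite ℤ G] [Module.Finite ℤ G']
    {Δ : Fan G} {Δ' : Fan G'} (φ : FanHom Δ Δ') : Δ.toricScheme R ⟶ Δ'.toricScheme R :=
  colimit.desc (Δ.diagram R)
    { pt := Δ'.toricScheme R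
      ι :=
        { app := fun P => chartMap R φ.toAddMonoidHom (φ.exists_map_le P.1 P.2).choose_spec.2 ≫
            Δ'.chartι R (φ.exists_map_le P.1 P.2).choose_spec.1
          naturality := fun P Q f => by
            have h := (φ.exists_map_le Q.1 Q.2).choose_spec.2
            have hPQ : P.1.map φ.toAddMonoidHom ≤ (φ.exists_map_le Q.1 Q.2).choose :=
              (AddSubmonoid.gc_map_comap _).monotone_l (leOfHom f) |>.trans h
            have key : chartMap R (AddMonoidHom.id G) (map_id_le (leOfHom f)) ≫
                (chartMap R φ.toAddMonoidHom h ≫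
                  Δ'.chartι R (φ.exists_map_le Q.1 Q.2).choose_spec.1) =
                chartMap R φ.toAddMonoidHom (φ.exists_map_le P.1 P.2).choose_spec.2 ≫
                  Δ'.chartι R (φ.exists_map_le P.1 P.2).choose_spec.1 := by
              rw [← Category.assoc, chartMap_comp R _ _ _ _ φ.toAddMonoidHom hPQ rfl]
              exact Δ'.chartMap_chartι_eq R _ _ _ _ _
            exact key.trans (Category.comp_id _).symm } }

theorem FanHom.chartι_toricMap (R : Type u) [CommRing R] [Module.Finite ℤ G]
    [Module.Finite ℤ G'] {Δ : Fan G} {Δ' : Fan G'} (φ : FanHom Δ Δ') {P : AddSubmonoid G}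
    (hP : P ∈ Δ.cones) {P' : AddSubmonoid G'} (hP' : P' ∈ Δ'.cones)
    (h : P.map φ.toAddMonoidHom ≤ P') :
    Δ.chartι R hP ≫ φ.toricMap R = chartMap R φ.toAddMonoidHom h ≫ Δ'.chartι R hP' :=
  (colimit.ι_desc _ _).trans (Δ'.chartMap_chartι_eq R _ _ _ _ _)

end Schemes

end ToricFan

namespace ToricFan

/-! ### Faces, duality and separation of convex cones. -/

section Monoids

/-! Everything rests on a dictionary between cones and points. The preimage of `U_{P'}` is the union
of the charts `U_P` with `P` in `Δ_{P'}` (`FanHom.preimage_chartOpen`), and an integral point `x` of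
`G` is a one-parameter subgroup `σ ↦ t ^ σ(x)` of the torus `U_0`, which extends over `t = 0` inside
`U_P` exactly when `x ∈ P`. The last point uses biduality of convex cones.

Necessity. The distinguished point of `U_P` lies only in charts `U_Q` with `P ≤ Q`. If the preimage
of `U_{P'}` is quasi-compact, the cones of `Δ_{P'}` are therefore faces of finitely many of them,
and each has finitely many faces. If `φ x ∈ P'`, the one-parameter subgroup of `x` over the fraction
field of a power series ring `k[[t]]`, with `k` a residue field of `R`, maps to a point of `U_{P'}`
over `k[[t]]`. The lift given by the valuative criterion has its closed point in some `U_P` with `P`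
in `Δ_{P'}`, and then `t ^ σ(x)` is integral for all `σ` in the dual of `P`, so `x ∈ P`.

Sufficiency. Finiteness gives quasi-compactness, Gordan's lemma gives finite type, and separation of
two cones along their common face gives uniqueness of lifts. For existence, let a `K`-point lie in
`U_P` with `P` minimal. Its nonvanishing monomials are those in `P^⊥`, and a lift to `U_Q` with `P ≤
Q` needs only that the monomials in `Q^∨ ∩ P^⊥` have integral values. The value group is arbitrary,
so the valuation itself is not a point of `G`. But if every `Q` failed, finitely many monomials
would witness this, and a functional positive on these witnesses is an honest point of `G`. Moved
far into `P`, it lies over `P'` but in no cone of `Δ_{P'}`, against the hypothesis. This is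
`exists_cone_forall_mem`. -/

theorem isFace_iff {G : Type*} [AddCommGroup G] {P Q : AddSubmonoid G} :
    IsFace P Q ↔ Q ≤ P ∧ ∀ x ∈ P, ∀ y ∈ P, x + y ∈ Q → x ∈ Q := by
  constructor
  · intro h
    refine ⟨h.le, fun x hx y hy hxy => ?_⟩
    obtain ⟨I, -, hQ⟩ := h
    have hIQ : ∀ y : P, y ∈ I ↔ (y : G) ∉ Q := by
      intro y
      rw [← SetLike.mem_coe (p := Q), hQ]
      simp
    by_contra hx'
    have h1 : (⟨y, hy⟩ : P) + ⟨x, hx⟩ ∈ I := AddSemigroupIdeal.add_mem I _ ((hIQ ⟨x, hx⟩).2 hx')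
    exact (hIQ _).1 h1 (by simpa [add_comm] using hxy)
  · rintro ⟨hle, h⟩
    refine ⟨⟨{x | (x : G) ∉ Q}, fun a b hb hab => hb (h b b.2 a a.2 ?_)⟩,
      ⟨Q.comap P.subtype, ?_⟩, ?_⟩
    · rw [add_comm]
      exact hab
    · ext x
      exact (not_not (a := (x : G) ∈ Q)).symm
    · ext x
      simp only [SetLike.mem_coe, Set.mem_image, Set.mem_compl_iff, Subtype.exists,
        exists_and_right, exists_eq_right]
      constructor
      · exact fun hx => ⟨hle hx, fun h' => h' hx⟩
      · rintro ⟨hx, h'⟩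
        exact not_not.1 h'

theorem IsFace.mem_of_add_mem {G : Type*} [AddCommGroup G] {P Q : AddSubmonoid G}
    (h : IsFace P Q) {x y : G} (hx : x ∈ P) (hy : y ∈ P) (hxy : x + y ∈ Q) : x ∈ Q :=
  (isFace_iff.1 h).2 x hx y hy hxy

/-- A face is generated by those generators of `P` that it contains. -/
theorem IsFace.finite_setOf {G : Type*} [AddCommGroup G] {P : AddSubmonoid G} (hP : P.FG) :
    {Q | IsFace P Q}.Finite := by
  obtain ⟨s, hs⟩ := hP
  refine ((s : Set G).toFinite.finite_subsets.image AddSubmonoid.closure).subset fun Q hQ => ?_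
  refine ⟨{x ∈ (s : Set G) | x ∈ Q}, fun x hx => hx.1, le_antisymm ?_ fun x hx => ?_⟩
  · exact (AddSubmonoid.closure_le).2 fun x hx => hx.2
  · have hxP := hQ.le hx
    have hmem : ∀ y ∈ AddSubmonoid.closure (s : Set G), y ∈ P := fun y hy => hs ▸ hy
    rw [← hs] at hxP
    induction hxP using AddSubmonoid.closure_induction with
    | mem x hxs => exact AddSubmonoid.subset_closure ⟨hxs, hx⟩
    | zero => exact zero_mem _
    | add x y hx' hy' ihx ihy =>
      exact add_mem (ihx (hQ.mem_of_add_mem (hmem x hx') (hmem y hy') hx))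
        (ihy (hQ.mem_of_add_mem (hmem y hy') (hmem x hx') (add_comm x y ▸ hx)))

/-- The face cut out by an element of the dual cone. -/
def cutOut {G : Type*} [AddCommGroup G] (P : AddSubmonoid G) (σ : G →+ ℤ) : AddSubmonoid G :=
  P ⊓ AddMonoidHom.mker σ

theorem mem_cutOut {G : Type*} [AddCommGroup G] {P : AddSubmonoid G} {σ : G →+ ℤ} {x : G} :
    x ∈ cutOut P σ ↔ x ∈ P ∧ σ x = 0 := Iff.rfl

theorem isFace_cutOut {G : Type*} [AddCommGroup G] {P : AddSubmonoid G} {σ : G →+ ℤ}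
    (hσ : σ ∈ dualCone P) : IsFace P (cutOut P σ) := by
  refine isFace_iff.2 ⟨inf_le_left, fun x hx y hy hxy => ⟨hx, ?_⟩⟩
  have h1 := hσ x hx
  have h2 := hσ y hy
  have h3 : σ x + σ y = 0 := by rw [← map_add]; exact hxy.2
  change σ x = 0
  omega

/-- An element of `P` that lies in no proper face. -/
theorem exists_interior {G : Type*} [AddCommGroup G] {P : AddSubmonoid G} (hP : P.FG) :
    ∃ p ∈ P, ∀ Q, IsFace P Q → p ∈ Q → P ≤ Q := by
  classical
  obtain ⟨s, hs⟩ := hP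
  have hsP : ∀ x ∈ s, x ∈ P := fun x hx => hs ▸ AddSubmonoid.subset_closure hx
  -- A face containing the sum of the generators contains every summand.
  refine ⟨∑ x ∈ s, x, P.sum_mem hsP, fun Q hQ hp => ?_⟩
  rw [← hs, AddSubmonoid.closure_le]
  intro x hx
  rw [← Finset.add_sum_erase s _ hx] at hp
  exact hQ.mem_of_add_mem (hsP x hx)
    (P.sum_mem fun y hy => hsP y (Finset.mem_of_mem_erase hy)) hp

/-- The units of `C` form a face, which some dual element cuts out. This is the source of all the
separating functionals below, applied to a different `C` each time. -/
theorem exists_dual_units {G : Type u} [AddCommGroup G] [Module.Finite ℤ G]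
    {C : AddSubmonoid G} (hC : C.FG) : ∃ m ∈ dualCone C, ∀ x ∈ C, m x = 0 ↔ -x ∈ C := by
  have hF : IsFace C (C ⊓ C.comap (negAddMonoidHom (α := G))) := by
    refine isFace_iff.2 ⟨inf_le_left, fun x hx y hy hxy => ⟨hx, ?_⟩⟩
    have h1 : -(x + y) ∈ C := hxy.2
    change -x ∈ C
    rw [show -x = -(x + y) + y by abel]
    exact C.add_mem h1 hy
  obtain ⟨m, hm, h⟩ := hF.exists_dual hC
  exact ⟨m, hm, fun x hx => (h x hx).trans ⟨fun h => h.2, fun h => ⟨hx, h⟩⟩⟩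

/-- A convex cone is the dual of its dual cone. -/
theorem IsConvexCone.mem_of_forall_dualCone {G : Type u} [AddCommGroup G] [Module.Finite ℤ G]
    {P : AddSubmonoid G} (hP : IsConvexCone P) {x : G} (hx : ∀ σ ∈ dualCone P, 0 ≤ σ x) :
    x ∈ P := by
  -- Adjoin `-x` to `P`. The functional `m` is nonnegative both at `x` and at `-x`, so `-x` is a
  -- unit of the larger monoid. Then `x = p - n • x` with `p ∈ P`, and torsion freeness and
  -- saturation bring `(n + 1) • x ∈ P` down to `x ∈ P`.
  have hfg : (AddSubmonoid.multiples (-x)).FG := ⟨{-x}, by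
    simp [AddSubmonoid.multiples_eq_closure]⟩
  obtain ⟨m, hm, h⟩ := exists_dual_units (hP.fg.sup hfg)
  have h1 := hx m fun y hy => hm y (AddSubmonoid.mem_sup_left hy)
  have hxC : -x ∈ P ⊔ AddSubmonoid.multiples (-x) :=
    AddSubmonoid.mem_sup_right (AddSubmonoid.mem_multiples _)
  have h2 := hm _ hxC
  rw [map_neg] at h2
  have h3 := (h _ hxC).1 (by rw [map_neg]; omega)
  rw [neg_neg, AddSubmonoid.mem_sup] at h3
  obtain ⟨p, hp, _, ⟨n, rfl⟩, hpx⟩ := h3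
  have h4 : (n + 1) • x ∈ P := by
    have : (n + 1) • x = p := by
      have : p = x - n • (-x) := eq_sub_of_add_eq hpx
      rw [this, smul_neg, succ_nsmul]
      abel
    rwa [this]
  refine hP.saturated x ?_ (n + 1) n.succ_pos h4
  have := hP.torsionFree
  rw [← QuotientAddGroup.eq_zero_iff]
  have h5 : (n + 1) • (QuotientAddGroup.mk x : G ⧸ AddSubgroup.closure (P : Set G)) = 0 := by
    rw [← QuotientAddGroup.mk_nsmul]
    exact (QuotientAddGroup.eq_zero_iff _).2 (AddSubgroup.subset_closure h4)
  exact (nsmul_eq_zero_iff_right n.succ_ne_zero).1 h5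

instance {G : Type*} [AddCommGroup G] [Module.Finite ℤ G] : Module.Finite ℤ (G →+ ℤ) := by
  have : Module.Finite ℤ (G →ₗ[ℤ] ℤ) := by
    obtain ⟨n, f, hf⟩ := Module.Finite.exists_fin' ℤ G
    exact Module.Finite.of_injective (LinearMap.lcomp ℤ ℤ f)
      (LinearMap.lcomp_injective_of_surjective f hf)
  exact Module.Finite.equiv (addMonoidHomLequivInt (A := G) (B := ℤ) ℤ).symm

/-- **Gordan's lemma**: dual cones are finitely generated. -/
theorem fg_dualCone {G : Type*} [AddCommGroup G] [Module.Finite ℤ G] {P : AddSubmonoid G}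
    (hP : P.FG) : (dualCone P).FG := by
  classical
  obtain ⟨t, ht⟩ := hP
  have htP : ∀ x ∈ t, x ∈ P := fun x hx => ht ▸ AddSubmonoid.subset_closure hx
  obtain ⟨s, hs⟩ : (⊤ : AddSubmonoid (G →+ ℤ)).FG := by
    have : AddGroup.FG (G →+ ℤ) := Module.Finite.iff_addGroup_fg.1 inferInstance
    exact (AddMonoid.fg_def).1 (AddGroup.fg_iff_addMonoid_fg.1 this)
  let f : (s → ℕ) →+ (G →+ ℤ) :=
    { toFun a := ∑ i, a i • (i : G →+ ℤ)
      map_zero' := by simp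
      map_add' a b := by simp [add_nsmul, Finset.sum_add_distrib] }
  have hf : Function.Surjective f := by
    rw [← AddMonoidHom.mrange_eq_top, eq_top_iff, ← hs, AddSubmonoid.closure_le]
    intro σ hσ
    exact ⟨Pi.single ⟨σ, hσ⟩ 1, by simp [f, Pi.single_apply, ite_smul]⟩
  -- With slack variables in `t → ℕ`, nonnegativity on the generators of `P` becomes an equation
  -- between additive maps on `ℕ`-vectors. Its solution monoid is finitely generated and maps onto
  -- the dual cone.
  let g₁ : (s → ℕ) × (t → ℕ) →+ (t → ℤ) :=
    (AddMonoidHom.pi fun x : t =>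
      (AddMonoidHom.eval (M := G) (N := ℤ) (x : G)).comp f).comp (AddMonoidHom.fst _ _)
  let g₂ : (s → ℕ) × (t → ℕ) →+ (t → ℤ) :=
    (AddMonoidHom.pi fun x : t => (Nat.castAddMonoidHom ℤ).comp (Pi.evalAddMonoidHom _ x)).comp
      (AddMonoidHom.snd _ _)
  have h := (AddSubmonoid.fg_eqLocusM g₁ g₂).map (f.comp (AddMonoidHom.fst _ _))
  convert h
  ext σ
  rw [AddSubmonoid.mem_map]
  constructor
  · intro hσ
    obtain ⟨a, rfl⟩ := hf σ
    refine ⟨(a, fun x => (f a x).toNat), ?_, rfl⟩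
    change g₁ _ = g₂ _
    funext x
    exact (Int.toNat_of_nonneg (hσ x (htP x x.2))).symm
  · rintro ⟨⟨a, b⟩, hab, rfl⟩ x hx
    change 0 ≤ f a x
    rw [← ht] at hx
    induction hx using AddSubmonoid.closure_induction with
    | mem x hx =>
      have : f a x = b ⟨x, hx⟩ := congrFun (show g₁ (a, b) = g₂ (a, b) from hab) ⟨x, hx⟩
      omega
    | zero => simp
    | add x y _ _ hx hy => rw [map_add]; exact add_nonneg hx hy

/-- Reflexivity of `G`: it turns a functional on the dual lattice into a point of `G`. -/
theorem exists_eq_eval {G : Type*} [AddCommGroup G] [Module.Finite ℤ G] [Module.Free ℤ G]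
    (m : (G →+ ℤ) →+ ℤ) : ∃ x : G, ∀ σ : G →+ ℤ, m σ = σ x := by
  let e := addMonoidHomLequivInt (A := G) (B := ℤ) ℤ
  obtain ⟨x, hx⟩ := (Module.evalEquiv ℤ G).surjective
    (m.toIntLinearMap.comp e.symm.toLinearMap)
  refine ⟨x, fun σ => ?_⟩
  have := LinearMap.congr_fun hx (e σ)
  exact (by simpa using this.symm : m σ = e σ x)

/-- Two cones meeting in a common face are separated by a hyperplane. -/
theorem exists_separating {G : Type u} [AddCommGroup G] [Module.Finite ℤ G]
    {P Q : AddSubmonoid G} (hP : P.FG) (hQ : Q.FG) (hPQ : IsFace P (P ⊓ Q))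
    (hQP : IsFace Q (P ⊓ Q)) :
    ∃ m ∈ dualCone P, -m ∈ dualCone Q ∧ (∀ x ∈ P, m x = 0 ↔ x ∈ P ⊓ Q) ∧
      ∀ x ∈ Q, m x = 0 ↔ x ∈ P ⊓ Q := by
  -- The cone `P - Q`. If `x ∈ P` is a unit in it, then `x + p = q` for some `p ∈ P` and `q ∈ Q`,
  -- which lies in the common face, and so does `x`. The argument for `Q` is symmetric.
  let C := P ⊔ Q.map (negAddMonoidHom (α := G))
  have memC : ∀ z, z ∈ C ↔ ∃ p ∈ P, ∃ q ∈ Q, z = p - q := by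
    intro z
    simp only [C, AddSubmonoid.mem_sup, AddSubmonoid.mem_map]
    constructor
    · rintro ⟨p, hp, _, ⟨q, hq, rfl⟩, rfl⟩
      exact ⟨p, hp, q, hq, (sub_eq_add_neg p q).symm⟩
    · rintro ⟨p, hp, q, hq, rfl⟩
      exact ⟨p, hp, _, ⟨q, hq, rfl⟩, (sub_eq_add_neg p q).symm⟩
  obtain ⟨m, hm, h⟩ := exists_dual_units (C := C) (hP.sup (hQ.map _))
  have hmP : ∀ x ∈ P, x ∈ C := fun x hx => AddSubmonoid.mem_sup_left hx
  have hmQ : ∀ x ∈ Q, -x ∈ C := fun x hx => AddSubmonoid.mem_sup_right ⟨x, hx, rfl⟩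
  refine ⟨m, fun x hx => hm x (hmP x hx), fun x hx => ?_, fun x hx => ?_, fun x hx => ?_⟩
  · have := hm _ (hmQ x hx)
    rwa [map_neg] at this
  · rw [h x (hmP x hx), memC]
    constructor
    · rintro ⟨p, hp, q, hq, hpq⟩
      have h1 : x + p = q := by rw [← neg_inj, neg_add, hpq]; abel
      exact hPQ.mem_of_add_mem hx hp ⟨P.add_mem hx hp, h1 ▸ hq⟩
    · exact fun hx => ⟨0, P.zero_mem, x, hx.2, by simp⟩
  · rw [← neg_eq_zero, ← map_neg, h _ (hmQ x hx), neg_neg, memC]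
    constructor
    · rintro ⟨p, hp, q, hq, rfl⟩
      exact hQP.mem_of_add_mem hx hq ⟨by simpa using hp, Q.add_mem hx hq⟩
    · exact fun hx => ⟨x, hx.1, 0, Q.zero_mem, by simp⟩

/-- Sharpness makes `0` a face of any cone. Its chart is the torus contained in every chart. -/
theorem Fan.bot_mem {G : Type*} [AddCommGroup G] (Δ : Fan G) : ⊥ ∈ Δ.cones := by
  obtain ⟨P, hP⟩ := Δ.nonempty
  refine Δ.face_mem P hP _ (isFace_iff.2 ⟨bot_le, fun x hx y hy hxy => ?_⟩)
  have h : x + y = 0 := hxy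
  rw [add_eq_zero_iff_neg_eq] at h
  exact (Δ.isConvexCone P hP).sharp x hx (h ▸ hy)

end Monoids

/-! ### Charts as open subsets, and their preimages. -/

noncomputable section Schemes

variable (R : Type u) [CommRing R] {G G' : Type u} [AddCommGroup G] [AddCommGroup G']
  [Module.Finite ℤ G] [Module.Finite ℤ G']

/-- The monomial of an element of the dual cone. -/
abbrev monomial {P : AddSubmonoid G} {σ : G →+ ℤ} (hσ : σ ∈ dualCone P) :
    AddMonoidAlgebra R (dualCone P) :=
  AddMonoidAlgebra.single ⟨σ, hσ⟩ 1

omit [Module.Finite ℤ G] in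
theorem monomial_zero {P : AddSubmonoid G} : monomial R (zero_mem (dualCone P)) = 1 := rfl

omit [Module.Finite ℤ G] in
theorem monomial_mul {P : AddSubmonoid G} {σ τ : G →+ ℤ} (hσ : σ ∈ dualCone P)
    (hτ : τ ∈ dualCone P) :
    monomial R hσ * monomial R hτ = monomial R (add_mem hσ hτ) := by
  rw [monomial, monomial, AddMonoidAlgebra.single_mul_single, mul_one]
  rfl

omit [Module.Finite ℤ G] in
theorem monomial_mul_eq_one {P : AddSubmonoid G} {σ τ : G →+ ℤ} (hσ : σ ∈ dualCone P)
    (hτ : τ ∈ dualCone P) (h : σ + τ = 0) : monomial R hσ * monomial R hτ = 1 := by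
  rw [monomial_mul, AddMonoidAlgebra.one_def]
  exact congrArg (AddMonoidAlgebra.single · 1) (Subtype.ext h)

omit [Module.Finite ℤ G] [Module.Finite ℤ G'] in
theorem comp_mem_dualCone {P : AddSubmonoid G} {P' : AddSubmonoid G'} {φ : G →+ G'}
    (h : P.map φ ≤ P') {σ : G' →+ ℤ} (hσ : σ ∈ dualCone P') : σ.comp φ ∈ dualCone P :=
  (dualConeMap φ h ⟨σ, hσ⟩).2

omit [Module.Finite ℤ G] in
theorem dualCone_anti {P Q : AddSubmonoid G} (h : Q ≤ P) {σ : G →+ ℤ} (hσ : σ ∈ dualCone P) :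
    σ ∈ dualCone Q :=
  fun x hx => hσ x (h hx)

omit [Module.Finite ℤ G] [Module.Finite ℤ G'] in
theorem chartRingMap_monomial {P : AddSubmonoid G} {P' : AddSubmonoid G'} (φ : G →+ G')
    (h : P.map φ ≤ P') {σ : G' →+ ℤ} (hσ : σ ∈ dualCone P') :
    chartRingMap R φ h (monomial R hσ) = monomial R (comp_mem_dualCone h hσ) := by
  rw [chartRingMap, AddMonoidAlgebra.mapDomainRingHom_apply, AddMonoidAlgebra.mapDomain_single]
  rfl

omit [Module.Finite ℤ G] in
theorem chartRingMap_id_monomial {P Q : AddSubmonoid G} (h : Q ≤ P) {σ : G →+ ℤ}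
    (hσ : σ ∈ dualCone P) :
    chartRingMap R (AddMonoidHom.id G) (map_id_le h) (monomial R hσ) =
      monomial R (dualCone_anti h hσ) :=
  chartRingMap_monomial R _ _ hσ

omit [Module.Finite ℤ G] [Module.Finite ℤ G'] in
theorem chartRingMap_algebraMap {P : AddSubmonoid G} {P' : AddSubmonoid G'} (φ : G →+ G')
    (h : P.map φ ≤ P') (r : R) :
    chartRingMap R φ h (algebraMap R _ r) = algebraMap R _ r := by
  simp [chartRingMap]

omit [Module.Finite ℤ G] in
instance {P : AddSubmonoid G} : IsAffine (chart R P) := by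
  unfold chart
  infer_instance

variable (Δ : Fan G) {Δ' : Fan G'} {P Q : AddSubmonoid G}

instance (hP : P ∈ Δ.cones) : IsOpenImmersion (Δ.chartι R hP) := by
  have h (P : Δ.cones) : IsOpenImmersion (colimit.ι (Δ.diagram R) P) := inferInstance
  exact h ⟨P, hP⟩

/-- The chart `U_P` as an open subset of the toric scheme. -/
def Fan.chartOpen (hP : P ∈ Δ.cones) : (Δ.toricScheme R).Opens := (Δ.chartι R hP).opensRange

variable {Δ}

theorem Fan.mem_chartOpen {hP : P ∈ Δ.cones} {y : Δ.toricScheme R} :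
    y ∈ Δ.chartOpen R hP ↔ ∃ x, Δ.chartι R hP x = y := Iff.rfl

theorem Fan.isAffineOpen_chartOpen (hP : P ∈ Δ.cones) : IsAffineOpen (Δ.chartOpen R hP) :=
  isAffineOpen_opensRange _

theorem Fan.exists_mem_chartOpen (y : Δ.toricScheme R) :
    ∃ (P : AddSubmonoid G) (hP : P ∈ Δ.cones), y ∈ Δ.chartOpen R hP := by
  obtain ⟨P, x, hx⟩ := Scheme.IsLocallyDirected.ι_jointly_surjective (Δ.diagram R) y
  exact ⟨P.1, P.2, x, hx⟩

theorem Fan.chartOpen_mono (hP : P ∈ Δ.cones) (hQ : Q ∈ Δ.cones) (h : Q ≤ P) :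
    Δ.chartOpen R hQ ≤ Δ.chartOpen R hP := by
  rintro _ ⟨x, rfl⟩
  rw [← Δ.chartMap_chartι R hP hQ (map_id_le h), Scheme.Hom.comp_apply]
  exact ⟨_, rfl⟩

theorem Fan.chartOpen_inf (hP : P ∈ Δ.cones) (hQ : Q ∈ Δ.cones) :
    Δ.chartOpen R hP ⊓ Δ.chartOpen R hQ = Δ.chartOpen R (Δ.inf_mem hP hQ) := by
  refine le_antisymm ?_
    (le_inf (chartOpen_mono R _ _ inf_le_left) (chartOpen_mono R _ _ inf_le_right))
  rintro _ ⟨⟨x, rfl⟩, ⟨y, hy⟩⟩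
  obtain ⟨T, fP, fQ, z, hz, -⟩ := (Scheme.IsLocallyDirected.ι_eq_ι_iff (Δ.diagram R)
    (i := ⟨P, hP⟩) (j := ⟨Q, hQ⟩)).1 hy.symm
  refine chartOpen_mono R _ T.2 (le_inf (leOfHom fP) (leOfHom fQ)) ⟨z, ?_⟩
  have h := congr($(Δ.chartMap_chartι R hP T.2 (map_id_le (leOfHom fP))) z)
  exact h.symm.trans (congrArg (Δ.chartι R hP) hz)

/-- The prime ideal of a point of a chart. -/
def chartIdeal (x : chart R P) : Ideal (AddMonoidAlgebra R (dualCone P)) :=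
  PrimeSpectrum.asIdeal (R := AddMonoidAlgebra R (dualCone P)) x

/-- Inside `U_P`, the chart `U_Q` is the locus where the monomial of `m` is invertible. -/
theorem Fan.chartι_mem_chartOpen_iff (hP : P ∈ Δ.cones) (hQ : Q ∈ Δ.cones) (hle : Q ≤ P)
    {m : G →+ ℤ} (hm : m ∈ dualCone P) (hmQ : ∀ x ∈ P, m x = 0 ↔ x ∈ Q) (x : chart R P) :
    Δ.chartι R hP x ∈ Δ.chartOpen R hQ ↔
      monomial R hm ∉ chartIdeal R x := by
  have hr := range_chartMap R (Δ.isConvexCone P hP).fg hle ⟨m, hm⟩ hmQ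
  have hx : monomial R hm ∉ chartIdeal R x ↔
      x ∈ Set.range (chartMap R (AddMonoidHom.id G) (map_id_le hle)) :=
    (Set.ext_iff.1 hr x).symm
  rw [hx, Fan.mem_chartOpen, ← Δ.chartMap_chartι R hP hQ (map_id_le hle)]
  simp only [Scheme.Hom.comp_apply]
  constructor
  · rintro ⟨z, hz⟩
    exact ⟨z, (Δ.chartι R hP).isOpenEmbedding.injective hz⟩
  · rintro ⟨z, hz⟩
    exact ⟨z, congrArg _ hz⟩

omit [Module.Finite ℤ G] in
theorem Fan.cutOut_mem (hP : P ∈ Δ.cones) {σ : G →+ ℤ} (hσ : σ ∈ dualCone P) :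
    cutOut P σ ∈ Δ.cones :=
  Δ.face_mem P hP _ (isFace_cutOut hσ)

theorem Fan.chartι_mem_cutOut_iff (hP : P ∈ Δ.cones)
    {σ : G →+ ℤ} (hσ : σ ∈ dualCone P) (x : chart R P) :
    Δ.chartι R hP x ∈ Δ.chartOpen R (cutOut_mem hP hσ) ↔
      monomial R hσ ∉ chartIdeal R x :=
  chartι_mem_chartOpen_iff R hP _ inf_le_left hσ (fun _ hx => (and_iff_right hx).symm) x

/-- If `φ(P) ⊆ P''` and a point of `U_P` maps into `U_{P'' ∩ P'}`, pull back the functional cutting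
out `P'' ∩ P'` in `P''`. It cuts out a face of `P` that maps into `P'` and whose chart contains the
point. -/
theorem FanHom.toricMap_mem_chartOpen_iff (φ : FanHom Δ Δ') {P' : AddSubmonoid G'}
    (hP' : P' ∈ Δ'.cones) (y : Δ.toricScheme R) :
    φ.toricMap R y ∈ Δ'.chartOpen R hP' ↔ ∃ (P : AddSubmonoid G) (hP : P ∈ Δ.cones),
      P.map φ.toAddMonoidHom ≤ P' ∧ y ∈ Δ.chartOpen R hP := by
  constructor
  · intro hy
    obtain ⟨P, hP, x, rfl⟩ := Fan.exists_mem_chartOpen R y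
    obtain ⟨P'', hP'', hφ⟩ := φ.exists_map_le P hP
    have h1 : φ.toricMap R (Δ.chartι R hP x) =
        Δ'.chartι R hP'' (chartMap R φ.toAddMonoidHom hφ x) := by
      rw [← Scheme.Hom.comp_apply, φ.chartι_toricMap R hP hP'' hφ, Scheme.Hom.comp_apply]
    have h2 : Δ'.chartι R hP'' (chartMap R φ.toAddMonoidHom hφ x) ∈
        Δ'.chartOpen R (Δ'.inf_mem hP'' hP') := by
      rw [← Fan.chartOpen_inf R hP'' hP']
      exact ⟨⟨_, rfl⟩, h1 ▸ hy⟩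
    obtain ⟨m, hm, hmT⟩ := (Δ'.inter _ hP'' _ hP').1.exists_dual (Δ'.isConvexCone _ hP'').fg
    rw [Fan.chartι_mem_chartOpen_iff R hP'' _ inf_le_left hm hmT] at h2
    have hm' : m.comp φ.toAddMonoidHom ∈ dualCone P :=
      comp_mem_dualCone hφ hm
    refine ⟨cutOut P (m.comp φ.toAddMonoidHom), Fan.cutOut_mem hP hm', ?_, ?_⟩
    · rintro _ ⟨z, hz, rfl⟩
      exact ((hmT _ (hφ ⟨z, hz.1, rfl⟩)).1 hz.2).2
    · rw [Fan.chartι_mem_cutOut_iff R hP hm']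
      rw [← chartRingMap_monomial R φ.toAddMonoidHom hφ hm]
      exact h2
  · rintro ⟨P, hP, h, x, rfl⟩
    rw [← Scheme.Hom.comp_apply, φ.chartι_toricMap R hP hP' h, Scheme.Hom.comp_apply]
    exact ⟨_, rfl⟩

theorem FanHom.preimage_chartOpen (φ : FanHom Δ Δ') {P' : AddSubmonoid G'}
    (hP' : P' ∈ Δ'.cones) :
    ((φ.toricMap R ⁻¹ᵁ Δ'.chartOpen R hP' : (Δ.toricScheme R).Opens) : Set (Δ.toricScheme R)) =
      ⋃ P : {P ∈ Δ.cones | P.map φ.toAddMonoidHom ≤ P'}, (Δ.chartOpen R P.2.1 : Set _) := by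
  ext y
  refine (φ.toricMap_mem_chartOpen_iff R hP' y).trans ?_
  simp only [Set.mem_iUnion, SetLike.mem_coe]
  exact ⟨fun ⟨P, hP, h, hy⟩ => ⟨⟨P, hP, h⟩, hy⟩, fun ⟨P, hy⟩ => ⟨P.1, P.2.1, P.2.2, hy⟩⟩

/-! ### Finiteness properties of toric morphisms. -/

theorem Fan.isOpenCover_chartOpen :
    TopologicalSpace.IsOpenCover fun P : Δ.cones => Δ.chartOpen R P.2 := by
  rw [TopologicalSpace.IsOpenCover, eq_top_iff]
  rintro y -
  obtain ⟨P, hP, hy⟩ := exists_mem_chartOpen R y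
  exact TopologicalSpace.Opens.mem_iSup.2 ⟨⟨P, hP⟩, hy⟩

instance : QuasiSeparatedSpace (Δ.toricScheme R) :=
  Scheme.quasiSeparatedSpace_of_isOpenCover _ (Fan.isOpenCover_chartOpen R)
    (fun P => Fan.isAffineOpen_chartOpen R P.2) fun P Q => by
      have := (Fan.isAffineOpen_chartOpen R (Δ.inf_mem P.2 Q.2)).isCompact
      rwa [← Fan.chartOpen_inf] at this

omit [Module.Finite ℤ G'] in
theorem finiteType_chartRingMap (hP : P.FG) {P' : AddSubmonoid G'} (φ : G →+ G')
    (h : P.map φ ≤ P') : (chartRingMap R φ h).FiniteType := by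
  have : AddMonoid.FG (dualCone P) := (AddMonoid.fg_iff_addSubmonoid_fg _).2 (fg_dualCone hP)
  refine RingHom.FiniteType.of_comp_finiteType
    (f := (algebraMap R (AddMonoidAlgebra R (dualCone P')))) ?_
  have h1 : (chartRingMap R φ h).comp (algebraMap R (AddMonoidAlgebra R (dualCone P'))) =
      algebraMap R (AddMonoidAlgebra R (dualCone P)) :=
    RingHom.ext (chartRingMap_algebraMap R φ h)
  rw [h1]
  exact RingHom.finiteType_algebraMap.2 inferInstance

instance (φ : FanHom Δ Δ') : LocallyOfFiniteType (φ.toricMap R) := by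
  have := HasRingHomProperty.instIsZariskiLocalAtSource (P := @LocallyOfFiniteType.{u})
    (Q := RingHom.FiniteType)
  refine (IsZariskiLocalAtSource.iff_of_openCover (P := @LocallyOfFiniteType.{u})
    (Scheme.IsLocallyDirected.openCover (Δ.diagram R))).2 fun P => ?_
  obtain ⟨P', hP', h⟩ := φ.exists_map_le P.1 P.2
  change LocallyOfFiniteType (Δ.chartι R P.2 ≫ φ.toricMap R)
  rw [φ.chartι_toricMap R P.2 hP' h]
  have : LocallyOfFiniteType (chartMap R φ.toAddMonoidHom h) :=
    (HasRingHomProperty.Spec_iff (P := @LocallyOfFiniteType.{u})).2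
      (finiteType_chartRingMap R (Δ.isConvexCone _ P.2).fg _ h)
  infer_instance

theorem FanHom.quasiCompact_toricMap (φ : FanHom Δ Δ')
    (h : ∀ P' ∈ Δ'.cones, {P ∈ Δ.cones | P.map φ.toAddMonoidHom ≤ P'}.Finite) :
    QuasiCompact (φ.toricMap R) := by
  have hloc : HasAffineProperty @QuasiCompact.{u} fun X _ _ _ => CompactSpace X :=
    instHasAffinePropertyQuasiCompactCompactSpaceCarrierCarrierCommRingCat
  refine (hloc.iff_of_iSup_eq_top (P := @QuasiCompact.{u})
    (fun P' : Δ'.cones => (⟨Δ'.chartOpen R P'.2, Fan.isAffineOpen_chartOpen R P'.2⟩ :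
      (Δ'.toricScheme R).affineOpens)) (Fan.isOpenCover_chartOpen R)).2 ?_
  intro P'
  have := (h P'.1 P'.2).to_subtype
  refine isCompact_iff_compactSpace.1 (?_ : IsCompact ((φ.toricMap R ⁻¹ᵁ Δ'.chartOpen R P'.2 :
    (Δ.toricScheme R).Opens) : Set (Δ.toricScheme R)))
  rw [φ.preimage_chartOpen R P'.2]
  exact isCompact_iUnion fun P => (Fan.isAffineOpen_chartOpen R P.2.1).isCompact

end Schemes

/-! ### The convexity argument behind existence of lifts. -/

section Monoids

theorem eventually_add_nsmul_neg {G : Type*} [AddCommGroup G] {σ : G →+ ℤ} {p : G}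
    (hσ : σ p < 0) (x : G) : ∀ᶠ N : ℕ in Filter.atTop, σ (x + N • p) < 0 := by
  filter_upwards [Filter.eventually_gt_atTop (σ x).natAbs] with N hN
  rw [map_add, map_nsmul, nsmul_eq_mul]
  have h1 : (N : ℤ) * σ p ≤ N * (-1) := mul_le_mul_of_nonneg_left (by omega) (by positivity)
  omega

/-- If the cones of `Δ` mapped into `P'` are finite in number and fill the preimage of `P'`, then
every total preorder on `P^⊥` that is nonnegative on the dual cone of `P'` is nonnegative on the
dual cone of some cone of `Δ` containing `P`. -/
theorem exists_cone_forall_mem {G G' : Type u} [AddCommGroup G] [AddCommGroup G']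
    [Module.Finite ℤ G] [Module.Free ℤ G] [Module.Finite ℤ G'] {Δ : Fan G} {φ : G →+ G'}
    {P' : AddSubmonoid G'} (hP' : IsConvexCone P')
    (hfin : {P ∈ Δ.cones | P.map φ ≤ P'}.Finite)
    (hunion : ∀ x, φ x ∈ P' → ∃ P ∈ Δ.cones, P.map φ ≤ P' ∧ x ∈ P)
    {P : AddSubmonoid G} (hP : P ∈ Δ.cones) (hPP' : P.map φ ≤ P')
    (B : AddSubmonoid (G →+ ℤ))
    (htotal : ∀ σ : G →+ ℤ, (∀ x ∈ P, σ x = 0) → σ ∈ B ∨ -σ ∈ B)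
    (hB : ∀ τ ∈ dualCone P', (∀ x ∈ P, τ (φ x) = 0) → τ.comp φ ∈ B) :
    ∃ Q ∈ Δ.cones, Q.map φ ≤ P' ∧ P ≤ Q ∧
      ∀ σ ∈ dualCone Q, (∀ x ∈ P, σ x = 0) → σ ∈ B := by
  classical
  by_contra! hcon
  -- `s Q` is a monomial exponent witnessing that `Q` fails.
  choose! s hs hsP hsB using hcon
  obtain ⟨t, ht⟩ := fg_dualCone hP'.fg
  have htP' : ∀ τ ∈ t, τ ∈ dualCone P' := fun τ hτ => ht ▸ AddSubmonoid.subset_closure hτ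
  let F := hfin.toFinset.filter (P ≤ ·)
  have hF : ∀ {Q}, Q ∈ F ↔ (Q ∈ Δ.cones ∧ Q.map φ ≤ P') ∧ P ≤ Q := by simp [F]
  let t₀ := t.filter fun τ => ∀ x ∈ P, τ (φ x) = 0
  -- All these generators lie in `B`, the first kind by totality. Since `s Q ∉ B`, no `-s Q` is a
  -- unit of `C`, so `m` below is strictly positive on it.
  let gen : Finset (G →+ ℤ) := F.image (fun Q => -s Q) ∪ t₀.image (fun τ => τ.comp φ)
  let C := AddSubmonoid.closure (gen : Set (G →+ ℤ))
  have hsC : ∀ Q ∈ F, -s Q ∈ C := fun Q hQ =>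
    AddSubmonoid.subset_closure (Finset.mem_union_left _ (Finset.mem_image_of_mem _ hQ))
  have htC : ∀ τ ∈ t₀, τ.comp φ ∈ C := fun τ hτ =>
    AddSubmonoid.subset_closure (Finset.mem_union_right _
      (Finset.mem_image_of_mem (fun τ : G' →+ ℤ => τ.comp φ) hτ))
  have hCB : C ≤ B := by
    rw [AddSubmonoid.closure_le]
    intro σ hσ
    rcases Finset.mem_union.1 hσ with hσ | hσ
    · obtain ⟨Q, hQ, rfl⟩ := Finset.mem_image.1 hσ
      obtain ⟨⟨h1, h2⟩, h3⟩ := hF.1 hQ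
      exact (htotal _ (hsP Q h1 h2 h3)).resolve_left (hsB Q h1 h2 h3)
    · obtain ⟨τ, hτ, rfl⟩ := Finset.mem_image.1 hσ
      obtain ⟨h1, h2⟩ := Finset.mem_filter.1 hτ
      exact hB τ (htP' τ h1) h2
  obtain ⟨m, hm, hm0⟩ := exists_dual_units (C := C) ⟨gen, rfl⟩
  obtain ⟨x, hx⟩ := exists_eq_eval m
  have hsx : ∀ Q ∈ F, s Q x < 0 := by
    intro Q hQ
    obtain ⟨⟨h1, h2⟩, h3⟩ := hF.1 hQ
    have h4 := hm _ (hsC Q hQ)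
    have h5 := (hm0 _ (hsC Q hQ)).not.2 fun h => hsB Q h1 h2 h3 (hCB (by simpa using h))
    rw [hx, AddMonoidHom.neg_apply] at h4 h5
    omega
  obtain ⟨p, hp, hpint⟩ := exists_interior (Δ.isConvexCone P hP).fg
  -- Functionals `τ` that vanish on `φ(P)` are nonnegative at `φ x` by choice of `x`. The others are
  -- positive at `φ p`, as `p` lies in no proper face, so a large `N` settles them.
  have hev₁ : ∀ᶠ N : ℕ in Filter.atTop, ∀ τ ∈ t, 0 ≤ τ (φ (x + N • p)) := by
    rw [Filter.eventually_all_finset]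
    intro τ hτ
    have hτP : τ.comp φ ∈ dualCone P := comp_mem_dualCone hPP' (htP' τ hτ)
    by_cases h0 : ∀ x ∈ P, τ (φ x) = 0
    · refine Filter.Eventually.of_forall fun N => ?_
      have h1 := hm _ (htC τ (Finset.mem_filter.2 ⟨hτ, h0⟩))
      rw [hx] at h1
      rw [map_add, map_add, map_nsmul, map_nsmul, h0 p hp, smul_zero, add_zero]
      exact h1
    · have h1 : 0 ≤ τ (φ p) := hτP p hp
      have h2 : τ (φ p) ≠ 0 := fun h =>
        h0 fun y hy => (hpint _ (isFace_cutOut hτP) ⟨hp, h⟩ hy).2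
      have h3 := eventually_add_nsmul_neg (σ := -τ.comp φ) (p := p)
        (by simp only [AddMonoidHom.neg_apply, AddMonoidHom.comp_apply]; omega) x
      filter_upwards [h3] with N hN
      simp only [AddMonoidHom.neg_apply, AddMonoidHom.comp_apply] at hN
      omega
  -- A cone missing `p` has a dual element negative at `p`, so the ray from `x` in direction `p`
  -- eventually leaves it. Finiteness makes one `N` serve all cones.
  have hev₂ : ∀ᶠ N : ℕ in Filter.atTop, ∀ Q ∈ hfin.toFinset, x + N • p ∈ Q → p ∈ Q := by
    rw [Filter.eventually_all_finset]
    intro Q hQ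
    have hQ' := (hfin.mem_toFinset.1 hQ).1
    by_cases hpQ : p ∈ Q
    · exact Filter.Eventually.of_forall fun _ _ => hpQ
    · obtain ⟨σ, hσ, hσp⟩ : ∃ σ ∈ dualCone Q, σ p < 0 := by
        by_contra! h
        exact hpQ ((Δ.isConvexCone Q hQ').mem_of_forall_dualCone h)
      filter_upwards [eventually_add_nsmul_neg hσp x] with N hN hmem
      exact absurd (hσ _ hmem) hN.not_ge
  obtain ⟨N, hN₁, hN₂⟩ := (hev₁.and hev₂).exists
  have hmem : φ (x + N • p) ∈ P' := by
    refine hP'.mem_of_forall_dualCone fun τ hτ => ?_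
    rw [← ht] at hτ
    induction hτ using AddSubmonoid.closure_induction with
    | mem τ hτ => exact hN₁ τ hτ
    | zero => simp
    | add σ τ _ _ hσ hτ => exact add_nonneg hσ hτ
  obtain ⟨Q, hQ, hQP', hxQ⟩ := hunion _ hmem
  have hpQ := hN₂ Q (hfin.mem_toFinset.2 ⟨hQ, hQP'⟩) hxQ
  have hPQ : P ≤ Q := (hpint _ (Δ.inter P hP Q hQ).1 ⟨hp, hpQ⟩).trans inf_le_right
  -- As `s Q` vanishes on `P`, adding `N • p` does not change its negative value at `x`.
  have h1 := hs Q hQ hQP' hPQ _ hxQ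
  rw [map_add, map_nsmul, hsP Q hQ hQP' hPQ p hp, smul_zero, add_zero] at h1
  exact absurd h1 (hsx Q (hF.2 ⟨⟨hQ, hQP'⟩, hPQ⟩)).not_ge

end Monoids

/-! ### Points with values in local and valuation rings, and uniqueness of lifts. -/

noncomputable section Schemes

variable (R : Type u) [CommRing R] {G G' : Type u} [AddCommGroup G] [AddCommGroup G']
  {P Q : AddSubmonoid G} {P' : AddSubmonoid G'} {A K : Type u} [CommRing A] [Field K]

variable {R} in
/-- The point of the chart `U_P` with values in `A` given by a ring homomorphism. -/
def chartPoint (f : AddMonoidAlgebra R (dualCone P) →+* A) : Spec (.of A) ⟶ chart R P :=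
  Spec.map (CommRingCat.ofHom f)

theorem chartPoint_chartMap (f : AddMonoidAlgebra R (dualCone P) →+* A) (φ : G →+ G')
    (h : P.map φ ≤ P') :
    chartPoint f ≫ chartMap R φ h = chartPoint (f.comp (chartRingMap R φ h)) :=
  (Spec.map_comp _ _).symm

theorem specMap_chartPoint {B : Type u} [CommRing B] (g : A →+* B)
    (f : AddMonoidAlgebra R (dualCone P) →+* A) :
    Spec.map (CommRingCat.ofHom g) ≫ chartPoint f = chartPoint (g.comp f) :=
  (Spec.map_comp _ _).symm

theorem chartPoint_injective :
    Function.Injective (chartPoint : (AddMonoidAlgebra R (dualCone P) →+* A) → _) :=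
  fun _ _ h => congrArg CommRingCat.Hom.hom (Spec.map_injective h)

theorem monomial_mem_chartIdeal_chartPoint [IsLocalRing A]
    (f : AddMonoidAlgebra R (dualCone P) →+* A) {σ : G →+ ℤ} (hσ : σ ∈ dualCone P) :
    monomial R hσ ∉ chartIdeal R (chartPoint f (IsLocalRing.closedPoint A)) ↔
      IsUnit (f (monomial R hσ)) := by
  have : monomial R hσ ∈ chartIdeal R (chartPoint f (IsLocalRing.closedPoint A)) ↔
      f (monomial R hσ) ∈ IsLocalRing.maximalIdeal A := Iff.rfl
  rw [this, IsLocalRing.mem_maximalIdeal, mem_nonunits_iff, not_not]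

variable [Module.Finite ℤ G] [Module.Finite ℤ G'] {Δ : Fan G} {Δ' : Fan G'}

theorem Fan.chartPoint_chartι_mem_iff [IsLocalRing A] (hP : P ∈ Δ.cones) (hQ : Q ∈ Δ.cones)
    (hle : Q ≤ P) {m : G →+ ℤ} (hm : m ∈ dualCone P) (hmQ : ∀ x ∈ P, m x = 0 ↔ x ∈ Q)
    (f : AddMonoidAlgebra R (dualCone P) →+* A) :
    (chartPoint f ≫ Δ.chartι R hP) (IsLocalRing.closedPoint A) ∈ Δ.chartOpen R hQ ↔
      IsUnit (f (monomial R hm)) := by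
  rw [← monomial_mem_chartIdeal_chartPoint,
    ← chartι_mem_chartOpen_iff R hP hQ hle hm hmQ]
  rfl

theorem Fan.chartPoint_chartι_mem (hP : P ∈ Δ.cones)
    (f : AddMonoidAlgebra R (dualCone P) →+* A) (x : Spec (.of A)) :
    (chartPoint f ≫ Δ.chartι R hP) x ∈ Δ.chartOpen R hP :=
  ⟨chartPoint f x, rfl⟩

/-- A point with values in a local ring whose closed point lies in `U_P` factors through `U_P`. -/
theorem Fan.exists_eq_chartPoint [IsLocalRing A] (hP : P ∈ Δ.cones)
    (g : Spec (.of A) ⟶ Δ.toricScheme R)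
    (hg : g (IsLocalRing.closedPoint A) ∈ Δ.chartOpen R hP) :
    ∃ f : AddMonoidAlgebra R (dualCone P) →+* A, g = chartPoint f ≫ Δ.chartι R hP := by
  have htop : g ⁻¹ᵁ Δ.chartOpen R hP = ⊤ := IsLocalRing.closed_point_mem_iff.mp hg
  have hrange : Set.range g ⊆ Set.range (Δ.chartι R hP) := by
    rintro _ ⟨x, rfl⟩
    have hx : x ∈ g ⁻¹ᵁ Δ.chartOpen R hP := htop ▸ trivial
    exact hx
  obtain ⟨l, hl⟩ : ∃ l, l ≫ Δ.chartι R hP = g := ⟨_, IsOpenImmersion.lift_fac _ g hrange⟩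
  have h1 : chartPoint (Spec.preimage l).hom = l := Spec.map_preimage l
  exact ⟨(Spec.preimage l).hom, by rw [h1, hl]⟩

theorem Fan.chartPoint_chartι_injective (hP : P ∈ Δ.cones)
    {f g : AddMonoidAlgebra R (dualCone P) →+* A}
    (h : chartPoint f ≫ Δ.chartι R hP = chartPoint g ≫ Δ.chartι R hP) : f = g :=
  chartPoint_injective R ((cancel_mono (Δ.chartι R hP)).1 h)

theorem Fan.chartPoint_comp_chartι (hP : P ∈ Δ.cones) (hQ : Q ∈ Δ.cones) (hle : Q ≤ P)
    (f : AddMonoidAlgebra R (dualCone Q) →+* A) :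
    chartPoint (f.comp (chartRingMap R (AddMonoidHom.id G) (map_id_le hle))) ≫ Δ.chartι R hP =
      chartPoint f ≫ Δ.chartι R hQ := by
  rw [← chartPoint_chartMap, Category.assoc, Δ.chartMap_chartι R hP hQ]

theorem FanHom.chartPoint_chartι_toricMap (φ : FanHom Δ Δ') (hP : P ∈ Δ.cones)
    (hP' : P' ∈ Δ'.cones) (h : P.map φ.toAddMonoidHom ≤ P')
    (f : AddMonoidAlgebra R (dualCone P) →+* A) :
    (chartPoint f ≫ Δ.chartι R hP) ≫ φ.toricMap R =
      chartPoint (f.comp (chartRingMap R φ.toAddMonoidHom h)) ≫ Δ'.chartι R hP' := by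
  rw [Category.assoc, φ.chartι_toricMap R hP hP' h, ← Category.assoc, chartPoint_chartMap]

/-- Points with values in a valuation ring are determined by their generic points. -/
theorem Fan.hom_ext_of_valuationRing [IsDomain A] [ValuationRing A] [Algebra A K]
    [IsFractionRing A K] (l₁ l₂ : Spec (.of A) ⟶ Δ.toricScheme R)
    (h : Spec.map (CommRingCat.ofHom (algebraMap A K)) ≫ l₁ =
      Spec.map (CommRingCat.ofHom (algebraMap A K)) ≫ l₂) : l₁ = l₂ := by
  have hinj : Function.Injective (algebraMap A K) := IsFractionRing.injective A K
  obtain ⟨P, hP, h₁⟩ := exists_mem_chartOpen R (l₁ (IsLocalRing.closedPoint A))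
  obtain ⟨Q, hQ, h₂⟩ := exists_mem_chartOpen R (l₂ (IsLocalRing.closedPoint A))
  obtain ⟨f₁, rfl⟩ := exists_eq_chartPoint R hP l₁ h₁
  obtain ⟨f₂, rfl⟩ := exists_eq_chartPoint R hQ l₂ h₂
  have hT := Δ.inf_mem hP hQ
  obtain ⟨m, hm, hmQ, hmPT, hmQT⟩ := exists_separating (Δ.isConvexCone P hP).fg
    (Δ.isConvexCone Q hQ).fg (Δ.inter P hP Q hQ).1 (Δ.inter P hP Q hQ).2
  rw [← Category.assoc, ← Category.assoc, specMap_chartPoint, specMap_chartPoint] at h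
  have hmemT : (chartPoint ((algebraMap A K).comp f₁) ≫ Δ.chartι R hP)
      (IsLocalRing.closedPoint K) ∈ Δ.chartOpen R hT := by
    rw [← chartOpen_inf R hP hQ]
    refine ⟨chartPoint_chartι_mem R hP _ _, ?_⟩
    rw [h]
    exact chartPoint_chartι_mem R hQ _ _
  obtain ⟨g, hg⟩ := exists_eq_chartPoint R hT _ hmemT
  have hg₁ := chartPoint_chartι_injective R hP
    (hg.trans (chartPoint_comp_chartι R hP hT inf_le_left g).symm)
  have hg₂ := chartPoint_chartι_injective R hQ
    ((h.symm.trans hg).trans (chartPoint_comp_chartι R hQ hT inf_le_right g).symm)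
  -- The monomials of `m` and `-m` take inverse values over `K`, but these values lie in `A`. Both
  -- are therefore units of `A`, and both closed points land in `U_{P ∩ Q}`.
  have hprod : f₁ (monomial R hm) * f₂ (monomial R hmQ) = 1 := by
    apply hinj
    have e₁ := RingHom.congr_fun hg₁ (monomial R hm)
    have e₂ := RingHom.congr_fun hg₂ (monomial R hmQ)
    rw [RingHom.comp_apply, RingHom.comp_apply, chartRingMap_id_monomial R inf_le_left] at e₁
    rw [RingHom.comp_apply, RingHom.comp_apply, chartRingMap_id_monomial R inf_le_right] at e₂
    rw [map_mul, e₁, e₂, ← map_mul, monomial_mul_eq_one R _ _ (add_neg_cancel m), map_one, map_one]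
  have hT₁ := (chartPoint_chartι_mem_iff R hP hT inf_le_left hm hmPT f₁).2
    (IsUnit.of_mul_eq_one _ hprod)
  have hT₂ := (chartPoint_chartι_mem_iff R hQ hT inf_le_right hmQ
    (fun x hx => by simpa using hmQT x hx) f₂).2
    (IsUnit.of_mul_eq_one _ ((mul_comm _ _).trans hprod))
  obtain ⟨g₁, e₁⟩ := exists_eq_chartPoint R hT _ hT₁
  obtain ⟨g₂, e₂⟩ := exists_eq_chartPoint R hT _ hT₂
  rw [← specMap_chartPoint, ← specMap_chartPoint, Category.assoc, Category.assoc, e₁, e₂,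
    ← Category.assoc, ← Category.assoc, specMap_chartPoint, specMap_chartPoint] at h
  rw [e₁, e₂, RingHom.cancel_left hinj |>.1 (chartPoint_chartι_injective R hT h)]

theorem FanHom.valuativeCriterion_uniqueness (φ : FanHom Δ Δ') :
    ValuativeCriterion.Uniqueness (φ.toricMap R) := fun S =>
  ⟨fun l₁ l₂ => CommSq.LiftStruct.ext
    (Fan.hom_ext_of_valuationRing R (K := S.K) _ _ (l₁.fac_left.trans l₂.fac_left.symm))⟩

end Schemes

/-! ### Existence of lifts and sufficiency. -/

noncomputable section Schemes

variable (R : Type u) [CommRing R] {G G' : Type u} [AddCommGroup G] [AddCommGroup G']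
  {P Q : AddSubmonoid G} {P' : AddSubmonoid G'} {A K : Type u} [CommRing A] [Field K]
  [Module.Finite ℤ G] [Module.Finite ℤ G'] {Δ : Fan G} {Δ' : Fan G'}

omit [Module.Finite ℤ G] in
/-- A ring homomorphism from `R[P^∨]` to `K` restricts to `R[Q^∨] → A` if it takes values in `A`
on coefficients and on the monomials in `Q^∨`. -/
theorem exists_algebraMap_comp [Algebra A K] (hinj : Function.Injective (algebraMap A K))
    (f : AddMonoidAlgebra R (dualCone Q) →+* K)
    (hR : ∀ r : R, f (algebraMap R _ r) ∈ (algebraMap A K).range)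
    (hσ : ∀ (σ : G →+ ℤ) (hσ : σ ∈ dualCone Q), f (monomial R hσ) ∈ (algebraMap A K).range) :
    ∃ g : AddMonoidAlgebra R (dualCone Q) →+* A, f = (algebraMap A K).comp g := by
  have hf : ∀ z, f z ∈ (algebraMap A K).range := by
    intro z
    induction z using AddMonoidAlgebra.induction_linear with
    | zero => rw [map_zero]; exact zero_mem _
    | add x y hx hy => rw [map_add]; exact add_mem hx hy
    | single σ r =>
      have : AddMonoidAlgebra.single σ r =
          algebraMap R (AddMonoidAlgebra R (dualCone Q)) r * monomial R σ.2 := by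
        rw [← Algebra.smul_def, monomial, AddMonoidAlgebra.smul_single, smul_eq_mul, mul_one]
      rw [this, map_mul]
      exact mul_mem (hR r) (hσ σ.1 σ.2)
  let e := RingEquiv.ofBijective (algebraMap A K).rangeRestrict
    ⟨fun x y h => hinj (congrArg Subtype.val h), (algebraMap A K).rangeRestrict_surjective⟩
  refine ⟨e.symm.toRingHom.comp (f.codRestrict _ hf), ?_⟩
  refine RingHom.ext fun z => ?_
  exact (congrArg Subtype.val (e.apply_symm_apply ⟨f z, hf z⟩)).symm

theorem FanHom.valuativeCriterion_existence [Module.Free ℤ G] (φ : FanHom Δ Δ')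
    (h : ∀ P' ∈ Δ'.cones, {P ∈ Δ.cones | P.map φ.toAddMonoidHom ≤ P'}.Finite ∧
      ∀ x, φ.toAddMonoidHom x ∈ P' →
        ∃ P ∈ Δ.cones, P.map φ.toAddMonoidHom ≤ P' ∧ x ∈ P) :
    ValuativeCriterion.Existence (φ.toricMap R) := by
  rintro ⟨A, K, κ, i₂, ⟨w⟩⟩
  have hinj : Function.Injective (algebraMap A K) := IsFractionRing.injective A K
  obtain ⟨P', hP', hi₂⟩ := Fan.exists_mem_chartOpen R (i₂ (IsLocalRing.closedPoint A))
  obtain ⟨g, rfl⟩ := Fan.exists_eq_chartPoint R hP' i₂ hi₂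
  obtain ⟨hfin, hunion⟩ := h P' hP'
  rw [← Category.assoc, specMap_chartPoint] at w
  let 𝒮 := {P | ∃ hP : P ∈ Δ.cones, P.map φ.toAddMonoidHom ≤ P' ∧
    κ (IsLocalRing.closedPoint K) ∈ Δ.chartOpen R hP}
  have hne : 𝒮.Nonempty := by
    obtain ⟨P, hP, hle, hmem⟩ := (φ.toricMap_mem_chartOpen_iff R hP'
      (κ (IsLocalRing.closedPoint K))).1 (by
        change (κ ≫ φ.toricMap R) (IsLocalRing.closedPoint K) ∈ _
        rw [w]
        exact Fan.chartPoint_chartι_mem R hP' _ _)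
    exact ⟨P, hP, hle, hmem⟩
  obtain ⟨P, ⟨hP, hPP', hκ⟩, hmin⟩ :=
    (hfin.subset (t := 𝒮) fun P hP => ⟨hP.1, hP.2.1⟩).exists_minimal hne
  obtain ⟨f, rfl⟩ := Fan.exists_eq_chartPoint R hP κ hκ
  rw [φ.chartPoint_chartι_toricMap R hP hP' hPP'] at w
  have hfg := Fan.chartPoint_chartι_injective R hP' w
  -- A nonvanishing monomial puts the point in the chart of the face it cuts out, which minimality
  -- of `P` forces to be all of `P`.
  have hne0 : ∀ (σ : G →+ ℤ) (hσ : σ ∈ dualCone P), f (monomial R hσ) ≠ 0 →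
      ∀ x ∈ P, σ x = 0 := by
    intro σ hσ hne x hx
    have hcut := (Fan.chartPoint_chartι_mem_iff R hP (Fan.cutOut_mem hP hσ) inf_le_left hσ
      (fun _ hx => (and_iff_right hx).symm) f).2 (isUnit_iff_ne_zero.2 hne)
    exact (hmin ⟨Fan.cutOut_mem hP hσ,
      ((AddSubmonoid.gc_map_comap _).monotone_l inf_le_left).trans hPP', hcut⟩ inf_le_left hx).2
  -- The exponents with integral value. On `P^⊥` the values are units of `K`, so `B` is total there
  -- because `A` is a valuation ring.
  let B : AddSubmonoid (G →+ ℤ) :=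
    { carrier := {σ | ∃ hσ : σ ∈ dualCone P, f (monomial R hσ) ∈ (algebraMap A K).range}
      zero_mem' := ⟨zero_mem _, by rw [monomial_zero, map_one]; exact one_mem _⟩
      add_mem' := by
        rintro σ τ ⟨hσ, h₁⟩ ⟨hτ, h₂⟩
        exact ⟨add_mem hσ hτ, by rw [← monomial_mul R hσ hτ, map_mul]; exact mul_mem h₁ h₂⟩ }
  obtain ⟨Q, hQ, hQP', hPQ, hQB⟩ := exists_cone_forall_mem (Δ'.isConvexCone P' hP') hfin hunion
    hP hPP' B (by
      intro σ hσ
      have h₁ : σ ∈ dualCone P := fun x hx => (hσ x hx).ge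
      have h₂ : -σ ∈ dualCone P := fun x hx => by simp [hσ x hx]
      have hprod : f (monomial R h₁) * f (monomial R h₂) = 1 := by
        rw [← map_mul, monomial_mul_eq_one R _ _ (add_neg_cancel σ), map_one]
      rcases ValuationRing.isInteger_or_isInteger A (f (monomial R h₁)) with hi | hi
      · exact Or.inl ⟨h₁, hi⟩
      · rw [← eq_inv_of_mul_eq_one_right hprod] at hi
        exact Or.inr ⟨h₂, hi⟩) (by
      intro τ hτ _
      refine ⟨comp_mem_dualCone hPP' hτ, ?_⟩
      rw [← chartRingMap_monomial R φ.toAddMonoidHom hPP' hτ]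
      exact ⟨g (monomial R hτ), (RingHom.congr_fun hfg (monomial R hτ)).symm⟩)
  obtain ⟨f', hf'⟩ := exists_algebraMap_comp R hinj
    (f.comp (chartRingMap R (AddMonoidHom.id G) (map_id_le hPQ)))
    (fun r => by
      refine ⟨g (algebraMap R _ r), ?_⟩
      rw [← RingHom.comp_apply, ← hfg, RingHom.comp_apply, RingHom.comp_apply]
      rw [chartRingMap_algebraMap, chartRingMap_algebraMap])
    (fun σ hσ => by
      rw [RingHom.comp_apply, chartRingMap_id_monomial R hPQ]
      -- A monomial of `Q^∨` either vanishes at the point or has exponent in `P^⊥`, where the choice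
      -- of `Q` applies.
      by_cases h0 : f (monomial R (dualCone_anti hPQ hσ)) = 0
      · rw [h0]
        exact zero_mem _
      · exact (hQB σ hσ (hne0 σ _ h0)).2)
  have hleft : Spec.map (CommRingCat.ofHom (algebraMap A K)) ≫ chartPoint f' ≫ Δ.chartι R hQ =
      chartPoint f ≫ Δ.chartι R hP := by
    rw [← Category.assoc, specMap_chartPoint, ← hf', Fan.chartPoint_comp_chartι R hQ hP hPQ]
  refine ⟨⟨⟨chartPoint f' ≫ Δ.chartι R hQ, hleft, ?_⟩⟩⟩
  -- The lower triangle commutes because its two sides agree over `K`.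
  refine Fan.hom_ext_of_valuationRing R (K := K) _ _ ?_
  change _ ≫ (chartPoint f' ≫ Δ.chartι R hQ) ≫ φ.toricMap R = _
  rw [← Category.assoc, hleft, φ.chartPoint_chartι_toricMap R hP hP' hPP', hfg,
    ← specMap_chartPoint, Category.assoc]

theorem FanHom.isProper_toricMap [Module.Free ℤ G] (φ : FanHom Δ Δ')
    (h : ∀ P' ∈ Δ'.cones, {P ∈ Δ.cones | P.map φ.toAddMonoidHom ≤ P'}.Finite ∧
      ∀ x, φ.toAddMonoidHom x ∈ P' →
        ∃ P ∈ Δ.cones, P.map φ.toAddMonoidHom ≤ P' ∧ x ∈ P) :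
    IsProper (φ.toricMap R) := by
  have := φ.quasiCompact_toricMap R fun P' hP' => (h P' hP').1
  exact IsProper.of_valuativeCriterion _ (ValuativeCriterion.iff.2
    ⟨φ.valuativeCriterion_existence R h, φ.valuativeCriterion_uniqueness R⟩)

/-! ### Necessity: distinguished points and one-parameter subgroups. -/

/-- The ring homomorphism `R[P^∨] → A` given by a character of `P^∨`. -/
def charRingHom [Algebra R A] (χ : Multiplicative (dualCone P) →* A) :
    AddMonoidAlgebra R (dualCone P) →+* A :=
  (AddMonoidAlgebra.lift R A (dualCone P) χ).toRingHom

omit [Module.Finite ℤ G] in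
theorem charRingHom_monomial [Algebra R A] (χ : Multiplicative (dualCone P) →* A) {σ : G →+ ℤ}
    (hσ : σ ∈ dualCone P) :
    charRingHom R χ (monomial R hσ) = χ (Multiplicative.ofAdd ⟨σ, hσ⟩) := by
  simp [charRingHom, monomial]

omit [Module.Finite ℤ G] in
theorem charRingHom_algebraMap [Algebra R A] (χ : Multiplicative (dualCone P) →* A) (r : R) :
    charRingHom R χ (algebraMap R _ r) = algebraMap R A r :=
  (AddMonoidAlgebra.lift R A (dualCone P) χ).commutes r

/-- The distinguished point of `U_P` lies in no smaller chart. -/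
theorem Fan.exists_mem_chartOpen_forall [Nontrivial R] (hP : P ∈ Δ.cones) :
    ∃ y ∈ Δ.chartOpen R hP, ∀ (Q : AddSubmonoid G) (hQ : Q ∈ Δ.cones),
      y ∈ Δ.chartOpen R hQ → P ≤ Q := by
  classical
  obtain ⟨I, hI⟩ := Ideal.exists_maximal R
  let _ := Ideal.Quotient.field I
  -- The indicator of `P^⊥`, multiplicative because `P^⊥` is a face of the dual cone. If the point
  -- lies in `U_Q`, the functional cutting out `P ∩ Q` in `P` must lie in `P^⊥`.
  let χ : Multiplicative (dualCone P) →* R ⧸ I :=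
    { toFun σ := if ∀ x ∈ P, σ.toAdd.1 x = 0 then 1 else 0
      map_one' := by simp
      map_mul' σ τ := by
        have h : (∀ x ∈ P, (σ * τ).toAdd.1 x = 0) ↔
            (∀ x ∈ P, σ.toAdd.1 x = 0) ∧ ∀ x ∈ P, τ.toAdd.1 x = 0 := by
          refine ⟨fun h => ⟨fun x hx => ?_, fun x hx => ?_⟩, fun h x hx => ?_⟩
          · have h₁ := σ.toAdd.2 x hx
            have h₂ := τ.toAdd.2 x hx
            have h₃ : σ.toAdd.1 x + τ.toAdd.1 x = 0 := h x hx
            omega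
          · have h₁ := σ.toAdd.2 x hx
            have h₂ := τ.toAdd.2 x hx
            have h₃ : σ.toAdd.1 x + τ.toAdd.1 x = 0 := h x hx
            omega
          · change σ.toAdd.1 x + τ.toAdd.1 x = 0
            rw [h.1 x hx, h.2 x hx, add_zero]
        simp only [h]
        split_ifs <;> simp_all }
  refine ⟨(chartPoint (charRingHom R χ) ≫ Δ.chartι R hP) (IsLocalRing.closedPoint _),
    chartPoint_chartι_mem R hP _ _, fun Q hQ hy => ?_⟩
  have hT : _ ∈ Δ.chartOpen R hP ⊓ Δ.chartOpen R hQ :=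
    ⟨chartPoint_chartι_mem R hP (charRingHom R χ) (IsLocalRing.closedPoint _), hy⟩
  rw [chartOpen_inf] at hT
  obtain ⟨m, hm, hmT⟩ := (Δ.inter P hP Q hQ).1.exists_dual (Δ.isConvexCone P hP).fg
  have hunit := (chartPoint_chartι_mem_iff R hP _ inf_le_left hm hmT _).1 hT
  rw [charRingHom_monomial] at hunit
  have h0 : ∀ x ∈ P, m x = 0 := by
    by_contra h0
    have : χ (Multiplicative.ofAdd ⟨m, hm⟩) = 0 := if_neg h0
    exact hunit.ne_zero this
  exact fun x hx => ((hmT x hx).1 (h0 x hx)).2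

/-- Finitely many charts cover the compact preimage of `U_{P'}`. Distinguished points show that
every cone over `P'` is a face of one of the corresponding cones. -/
theorem FanHom.finite_of_quasiCompact [Nontrivial R] (φ : FanHom Δ Δ')
    [QuasiCompact (φ.toricMap R)] (hP' : P' ∈ Δ'.cones) :
    {P ∈ Δ.cones | P.map φ.toAddMonoidHom ≤ P'}.Finite := by
  have hc : IsCompact ((φ.toricMap R ⁻¹ᵁ Δ'.chartOpen R hP' : (Δ.toricScheme R).Opens) :
      Set (Δ.toricScheme R)) :=
    (φ.toricMap R).isCompact_preimage (Fan.isAffineOpen_chartOpen R hP').isCompact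
  rw [φ.preimage_chartOpen R hP'] at hc
  obtain ⟨s, hs⟩ := hc.elim_finite_subcover _ (fun P => (Δ.chartOpen R P.2.1).isOpen) le_rfl
  refine (s.finite_toSet.biUnion (t := fun P => {Q | IsFace P.1 Q}) fun P _ =>
    IsFace.finite_setOf (Δ.isConvexCone _ P.2.1).fg).subset fun P hP => ?_
  obtain ⟨y, hy, hyP⟩ := Fan.exists_mem_chartOpen_forall R hP.1
  obtain ⟨Q, hQs, hQ⟩ := Set.mem_iUnion₂.1 (hs (Set.mem_iUnion.2 ⟨⟨P, hP⟩, hy⟩))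
  exact Set.mem_biUnion hQs (Δ.isFace_of_le Q.2.1 hP.1 (hyP _ Q.2.1 hQ))

/-- The limit at `t = 0` of the one-parameter subgroup of `x` exists downstairs because `φ x ∈ P'`.
The cone whose chart contains the lifted limit is the one containing `x`. -/
theorem FanHom.exists_mem_of_valuativeCriterion [Nontrivial R] (φ : FanHom Δ Δ')
    (hφ : ValuativeCriterion.Existence (φ.toricMap R)) (hP' : P' ∈ Δ'.cones) {x : G}
    (hx : φ.toAddMonoidHom x ∈ P') :
    ∃ P ∈ Δ.cones, P.map φ.toAddMonoidHom ≤ P' ∧ x ∈ P := by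
  obtain ⟨I, hI⟩ := Ideal.exists_maximal R
  let _ := Ideal.Quotient.field I
  let A := PowerSeries (R ⧸ I)
  let K := FractionRing A
  let t : K := algebraMap A K PowerSeries.X
  have hinj : Function.Injective (algebraMap A K) := IsFractionRing.injective A K
  have ht : t ≠ 0 := (map_ne_zero_iff _ hinj).2 PowerSeries.X_ne_zero
  have hbot : (⊥ : AddSubmonoid G).map φ.toAddMonoidHom ≤ P' := by simp
  let χ : Multiplicative (dualCone (⊥ : AddSubmonoid G)) →* K :=
    { toFun σ := t ^ (σ.toAdd.1 x)
      map_one' := zpow_zero t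
      map_mul' σ τ := zpow_add₀ ht _ _ }
  -- The exponents are nonnegative since `φ x ∈ P'`, so `toNat` truncates nothing.
  let χ' : Multiplicative (dualCone P') →* A :=
    { toFun σ := PowerSeries.X ^ (σ.toAdd.1 (φ.toAddMonoidHom x)).toNat
      map_one' := pow_zero _
      map_mul' σ τ := by
        rw [← pow_add, ← Int.toNat_add (σ.toAdd.2 _ hx) (τ.toAdd.2 _ hx)]
        rfl }
  have hw : (charRingHom R χ).comp (chartRingMap R φ.toAddMonoidHom hbot) =
      (algebraMap A K).comp (charRingHom R χ') := by
    refine AddMonoidAlgebra.ringHom_ext (fun r => ?_) fun σ => ?_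
    · have h₁ : AddMonoidAlgebra.single 0 r =
          algebraMap R (AddMonoidAlgebra R (dualCone P')) r := rfl
      rw [RingHom.comp_apply, RingHom.comp_apply, h₁, chartRingMap_algebraMap,
        charRingHom_algebraMap, charRingHom_algebraMap, ← IsScalarTower.algebraMap_apply]
    · change charRingHom R χ (chartRingMap R φ.toAddMonoidHom hbot (monomial R σ.2)) =
        algebraMap A K (charRingHom R χ' (monomial R σ.2))
      rw [chartRingMap_monomial, charRingHom_monomial, charRingHom_monomial]
      change t ^ (σ.1 (φ.toAddMonoidHom x)) =
        algebraMap A K (PowerSeries.X ^ (σ.1 (φ.toAddMonoidHom x)).toNat)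
      rw [map_pow, ← zpow_natCast, Int.toNat_of_nonneg (σ.2 _ hx)]
  have w : CommSq (chartPoint (charRingHom R χ) ≫ Δ.chartι R Δ.bot_mem)
      (Spec.map (CommRingCat.ofHom (algebraMap A K))) (φ.toricMap R)
      (chartPoint (charRingHom R χ') ≫ Δ'.chartι R hP') := ⟨by
    rw [φ.chartPoint_chartι_toricMap R Δ.bot_mem hP' hbot, hw, ← specMap_chartPoint,
      Category.assoc]⟩
  obtain ⟨l, hl₁, hl₂⟩ : ∃ l : Spec (.of A) ⟶ Δ.toricScheme R,
      Spec.map (CommRingCat.ofHom (algebraMap A K)) ≫ l =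
        chartPoint (charRingHom R χ) ≫ Δ.chartι R Δ.bot_mem ∧
      l ≫ φ.toricMap R = chartPoint (charRingHom R χ') ≫ Δ'.chartι R hP' := by
    obtain ⟨l, h₁, h₂⟩ := (hφ { R := A, K := K, commSq := w, .. }).exists_lift
    exact ⟨l, h₁, h₂⟩
  obtain ⟨P, hP, hPP', hlP⟩ := (φ.toricMap_mem_chartOpen_iff R hP'
    (l (IsLocalRing.closedPoint A))).1 (by
      change (l ≫ φ.toricMap R) (IsLocalRing.closedPoint A) ∈ _
      rw [hl₂]
      exact Fan.chartPoint_chartι_mem R hP' _ _)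
  refine ⟨P, hP, hPP', (Δ.isConvexCone P hP).mem_of_forall_dualCone fun σ hσ => ?_⟩
  obtain ⟨f, rfl⟩ := Fan.exists_eq_chartPoint R hP l hlP
  rw [← Category.assoc, specMap_chartPoint,
    ← Fan.chartPoint_comp_chartι R hP Δ.bot_mem bot_le] at hl₁
  have h₁ := RingHom.congr_fun (Fan.chartPoint_chartι_injective R hP hl₁) (monomial R hσ)
  rw [RingHom.comp_apply, RingHom.comp_apply, chartRingMap_id_monomial R bot_le,
    charRingHom_monomial] at h₁
  change algebraMap A K (f (monomial R hσ)) = t ^ (σ x) at h₁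
  by_contra! hneg
  -- A negative exponent would make a positive power of `X` invertible in the power series ring.
  have h₂ : f (monomial R hσ) * PowerSeries.X ^ (-σ x).toNat = 1 := by
    apply hinj
    rw [map_mul, h₁, map_pow, map_one, ← zpow_natCast, Int.toNat_of_nonneg (by omega)]
    change t ^ (σ x) * t ^ (-σ x) = 1
    rw [← zpow_add₀ ht, add_neg_cancel, zpow_zero]
  have h₃ : IsUnit (PowerSeries.X : A) :=
    (isUnit_pow_iff (by omega)).1 (IsUnit.of_mul_eq_one _ ((mul_comm _ _).trans h₂))
  exact PowerSeries.X_prime.not_isUnit h₃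

end Schemes

end ToricFan

theorem mainTheorem3 (R : Type u) [CommRing R] [Nontrivial R] {G G' : Type u}
    [AddCommGroup G] [Module.Free ℤ G] [Module.Finite ℤ G]
    [AddCommGroup G'] [Module.Free ℤ G'] [Module.Finite ℤ G']
    (Δ : ToricFan.Fan G) (Δ' : ToricFan.Fan G') (φ : ToricFan.FanHom Δ Δ') :
    IsProper (φ.toricMap R) ↔
      ∀ P' ∈ Δ'.cones,
        {P ∈ Δ.cones | P.map φ.toAddMonoidHom ≤ P'}.Finite ∧
        φ.toAddMonoidHom ⁻¹' (P' : Set G') =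
          ⋃ P ∈ {P ∈ Δ.cones | P.map φ.toAddMonoidHom ≤ P'}, (P : Set G) := by
  constructor
  · intro h P' hP'
    have hex : ValuativeCriterion.Existence (φ.toricMap R) := by
      have h₁ : UniversallyClosed (φ.toricMap R) := inferInstance
      rw [UniversallyClosed.eq_valuativeCriterion] at h₁
      exact h₁.1
    refine ⟨φ.finite_of_quasiCompact R hP', Set.Subset.antisymm (fun x hx => ?_)
      (Set.iUnion₂_subset fun P hP x hx => hP.2 ⟨x, hx, rfl⟩)⟩
    obtain ⟨P, hP, hle, hxP⟩ := φ.exists_mem_of_valuativeCriterion R hex hP' hx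
    exact Set.mem_biUnion (show P ∈ {P ∈ Δ.cones | P.map φ.toAddMonoidHom ≤ P'} from ⟨hP, hle⟩) hxP
  · intro h
    refine φ.isProper_toricMap R fun P' hP' => ⟨(h P' hP').1, fun x hx => ?_⟩
    have hx' : x ∈ φ.toAddMonoidHom ⁻¹' (P' : Set G') := hx
    rw [(h P' hP').2] at hx'
    obtain ⟨P, hP, hxP⟩ := Set.mem_iUnion₂.1 hx'
    exact ⟨P, hP.1, hP.2, hxP⟩
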